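/- Let $\mathbb K$ be an algebraically closed field of characteristic $0$. For $a=(a_2,a_4,a_5,a_6,a_7,a_8,a_9,a_{10},a_{11})\in V^9=\mathbb K^9$ let $\mu_a$ be the skew-symmetric bilinear map on $\mathbb K^9=\langle X_0,\dots,X_8\rangle$ given by $$\mu_a(X_0,X_i)=X_{i+1}\ (1\le i\le 7),\qquad \mu_a(X_i,X_j)=\varphi_a(X_i,X_j)\ (1\le i<j\le 8),$$ where for $u=(u_2,u_4,u_5,\dots,u_{11})\in\mathbb K^9$ the skew-symmetric bilinear map $\varphi_u$ is given by $$\begin{aligned} \varphi_u(X_1,X_6)&=u_2X_8,\quad \varphi_u(X_2,X_5)=u_4X_8,\quad \varphi_u(X_1,X_5)=(u_2+u_4)X_7+u_5X_8,\quad \varphi_u(X_3,X_4)=u_6X_8,\\ \varphi_u(X_2,X_4)&=(u_4+u_6)X_7+u_7X_8,\quad \varphi_u(X_1,X_4)=(u_2+2u_4+u_6)X_6+(u_5+u_7)X_7+u_8X_8,\\ \varphi_u(X_2,X_3)&=(u_4+u_6)X_6+u_7X_7+u_9X_8,\\ \varphi_u(X_1,X_3)&=(u_2+3u_4+2u_6)X_5+(u_5+2u_7)X_6+(u_8+u_9)X_7+u_{10}X_8,\\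 \varphi_u(X_1,X_2)&=(u_2+3u_4+2u_6)X_4+(u_5+2u_7)X_5+(u_8+u_9)X_6+u_{10}X_7+u_{11}X_8, \end{aligned}$$ all the other values on pairs $X_i,X_j$ with $i<j$ being $0$. Let $$Fil_9=\{a\in V^9:\ -3a_4^2+2a_6^2+2a_2a_6+a_4a_6=0\}$$ (for $a\in Fil_9$ the map $\mu_a$ is a filiform Lie bracket, and every $9$-dimensional filiform Lie algebra is isomorphic to one of these). The orbit in $Fil_9$ of a set of points of $Fil_9$ is the set of all $a\in Fil_9$ such that $\mu_a$ is isomorphic to $\mu_b$ for some $b$ in the set. A rigid $2$-parameter family in $Fil_9$ is a family of points of $Fil_9$, given by polynomials in two parameters that run over a nonempty Zariski open subset of $\mathbb K^2$, whose members define pairwise non-isomorphic Lie algebras and whose orbit is Zariski open in $Fil_9$. For $\mu=\mu_a$, $a\in Fil_9$, let $Z^2_{CR}(\mu,\mu)$ be the space of all $\varphi_u$ with $u_2a_6+u_4(\tfrac12a_6-3a_4)+u_6(2a_6+a_2+\tfrac12a_4)=0$, let $B^2_{CR}(\mu,\mu)$ be the space of the coboundaries $\delta f$, $\delta f(x,y)=\mu(f(x),y)+\mu(x,f(y))-f(\mu(x,y))$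 with $f\in gl(9,\mathbb K)$, that lie in $Z^2_{CR}(\mu,\mu)$, and let $H^2_{CR}(\mu,\mu)=Z^2_{CR}(\mu,\mu)/B^2_{CR}(\mu,\mu)$. Theorem. $Fil_9$ is the Zariski closure in $V^9$ of the orbit in $Fil_9$ of a rigid $2$-parameter family. For example, the family $$a_2=\tfrac{3t^2-t-2}{2},\quad a_4=t,\quad a_5=a_6=1,\quad a_7=0,\quad a_8=u,\quad a_9=a_{10}=a_{11}=0\qquad (t,u\in\mathbb K,\ t\ne 0,-1,-\tfrac12)$$ is a rigid $2$-parameter family, and the closure of its orbit is $Fil_9$. Moreover $\dim H^2_{CR}(\mu,\mu)=2$ for all its members, and $2$ is the minimal value of $\dim H^2_{CR}(\mu,\mu)$ on $Fil_9$. -/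

import Mathlib

namespace Filiform9

variable (K : Type*) [Field K]

/-- Bilinear maps on `K^9`, i.e. families of structure constants with respect to the standard
basis, which is written `X_0, ..., X_8`. -/
abbrev Bilin : Type _ := (Fin 9 → K) →ₗ[K] (Fin 9 → K) →ₗ[K] (Fin 9 → K)

variable {K}

instance : AddCommGroup (Bilin K) := LinearMap.addCommGroup

/-- The basis vector `X_k` of `K^9`. -/
def X (k : Fin 9) : Fin 9 → K := Pi.single k 1

/-- The alternating bilinear map with `(X_i, X_j) ↦ c i j` for `i < j`
(the entries `c i j` with `j ≤ i` are not used). -/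
def altBilin (c : Fin 9 → Fin 9 → (Fin 9 → K)) : Bilin K :=
  LinearMap.mk₂ K
    (fun x y => ∑ i, ∑ j, if i < j then (x i * y j - x j * y i) • c i j else 0)
    (fun x x' y => by
      simp only [← Finset.sum_add_distrib]
      refine Finset.sum_congr rfl fun i _ => Finset.sum_congr rfl fun j _ => ?_
      split_ifs
      · rw [← add_smul]; congr 1; simp only [Pi.add_apply]; ring
      · simp)
    (fun r x y => by
      simp only [Finset.smul_sum]
      refine Finset.sum_congr rfl fun i _ => Finset.sum_congr rfl fun j _ => ?_
      split_ifs
      · rw [smul_smul]; congr 1; simp only [Pi.smul_apply, smul_eq_mul]; ring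
      · simp)
    (fun x y y' => by
      simp only [← Finset.sum_add_distrib]
      refine Finset.sum_congr rfl fun i _ => Finset.sum_congr rfl fun j _ => ?_
      split_ifs
      · rw [← add_smul]; congr 1; simp only [Pi.add_apply]; ring
      · simp)
    (fun r x y => by
      simp only [Finset.smul_sum]
      refine Finset.sum_congr rfl fun i _ => Finset.sum_congr rfl fun j _ => ?_
      split_ifs
      · rw [smul_smul]; congr 1; simp only [Pi.smul_apply, smul_eq_mul]; ring
      · simp)

/-- The values on `(X_i, X_j)`, `1 ≤ i < j`, of the bilinear map with parameters
`(u_2, u_4, u_5, u_6, u_7, u_8, u_9, u_10, u_11) = (u 0, u 1, ..., u 8)`.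
All the values that are not listed are zero. -/
def table (u : Fin 9 → K) (i j : Fin 9) : Fin 9 → K :=
  let u2 := u 0
  let u4 := u 1
  let u5 := u 2
  let u6 := u 3
  let u7 := u 4
  let u8 := u 5
  let u9 := u 6
  let u10 := u 7
  let u11 := u 8
  match i, j with
  | 1, 6 => u2 • X 8
  | 2, 5 => u4 • X 8
  | 1, 5 => (u2 + u4) • X 7 + u5 • X 8
  | 3, 4 => u6 • X 8
  | 2, 4 => (u4 + u6) • X 7 + u7 • X 8
  | 1, 4 => (u2 + 2 * u4 + u6) • X 6 + (u5 + u7) • X 7 + u8 • X 8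
  | 2, 3 => (u4 + u6) • X 6 + u7 • X 7 + u9 • X 8
  | 1, 3 => (u2 + 3 * u4 + 2 * u6) • X 5 + (u5 + 2 * u7) • X 6 + (u8 + u9) • X 7 + u10 • X 8
  | 1, 2 => (u2 + 3 * u4 + 2 * u6) • X 4 + (u5 + 2 * u7) • X 5 + (u8 + u9) • X 6
      + u10 • X 7 + u11 • X 8
  | _, _ => 0

theorem table_add (u v : Fin 9 → K) (i j : Fin 9) :
    table (u + v) i j = table u i j + table v i j := by
  unfold table
  split <;> simp only [Pi.add_apply] <;> module

theorem table_smul (r : K) (u : Fin 9 → K) (i j : Fin 9) :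
    table (r • u) i j = r • table u i j := by
  unfold table
  split <;> simp only [Pi.smul_apply, smul_eq_mul] <;> module

/-- The alternating bilinear map `φ_u` given by `table u` (so that `φ_u (X_0, X_i) = 0`),
as a linear function of the parameters `u`. -/
def cochain : (Fin 9 → K) →ₗ[K] Bilin K where
  toFun u := altBilin (table u)
  map_add' u v := by
    refine LinearMap.ext fun x => LinearMap.ext fun y => ?_
    simp only [altBilin, LinearMap.mk₂_apply, LinearMap.add_apply, ← Finset.sum_add_distrib]
    refine Finset.sum_congr rfl fun i _ => Finset.sum_congr rfl fun j _ => ?_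
    split_ifs
    · rw [table_add, smul_add]
    · simp
  map_smul' r u := by
    refine LinearMap.ext fun x => LinearMap.ext fun y => ?_
    simp only [altBilin, LinearMap.mk₂_apply, LinearMap.smul_apply, Finset.smul_sum,
      RingHom.id_apply]
    refine Finset.sum_congr rfl fun i _ => Finset.sum_congr rfl fun j _ => ?_
    split_ifs
    · rw [table_smul, smul_comm]
    · simp

/-- The model filiform bracket: `(X_0, X_i) ↦ X_{i+1}` for `1 ≤ i ≤ 7`, and all the other
brackets of basis vectors are zero. -/
def model : Bilin K :=
  altBilin fun i j => if i = 0 ∧ 1 ≤ j ∧ j ≤ 7 then X (j + 1) else 0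

/-- The bracket `μ_a` with parameters
`(a_2, a_4, a_5, a_6, a_7, a_8, a_9, a_10, a_11) = (a 0, a 1, ..., a 8)`. -/
def mu (a : Fin 9 → K) : Bilin K := model + cochain a

variable (K) in
/-- The variety `Fil_9` in the space `V^9 = K^9` of parameters, with the equation
`-3 a_4² + 2 a_6² + 2 a_2 a_6 + a_4 a_6 = 0`. -/
def Fil9 : Set (Fin 9 → K) :=
  {a | -3 * (a 1) ^ 2 + 2 * (a 3) ^ 2 + 2 * a 0 * a 3 + a 1 * a 3 = 0}

/-- Isomorphism of brackets on `K^9`: to lie in the same orbit of `GL(9, K)`. -/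
def IsIsomorphic (μ ν : Bilin K) : Prop :=
  ∃ e : (Fin 9 → K) ≃ₗ[K] (Fin 9 → K), ∀ x y, e (μ x y) = ν (e x) (e y)

/-- The orbit in `Fil_9` of a set `S` of parameters: the algebras of `Fil_9` that are isomorphic
to a member of `S`. -/
def orbit (S : Set (Fin 9 → K)) : Set (Fin 9 → K) :=
  {a ∈ Fil9 K | ∃ b ∈ S, IsIsomorphic (mu a) (mu b)}

/-- The Zariski closure of a subset of the affine space `K^n`. -/
def zariskiClosure {n : ℕ} (S : Set (Fin n → K)) : Set (Fin n → K) :=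
  MvPolynomial.zeroLocus K (MvPolynomial.vanishingIdeal K S)

/-- `U` is a Zariski open subset of the subset `V` of the affine space `K^n`. -/
def IsZariskiOpenIn {n : ℕ} (U V : Set (Fin n → K)) : Prop :=
  ∃ I : Ideal (MvPolynomial (Fin n) K), U = V \ MvPolynomial.zeroLocus K I

/-- `(F s)_{s ∈ D}` is a rigid `p`-parameter family of algebras of `Fil_9`: an algebraic family,
parametrized by a nonempty Zariski open set `D` of `K^p`, of pairwise non isomorphic algebras
of `Fil_9`, whose orbit is open in `Fil_9`. -/
structure IsRigidFamily {p : ℕ} (D : Set (Fin p → K)) (F : (Fin p → K) → (Fin 9 → K)) :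
    Prop where
  nonempty : D.Nonempty
  isOpen_domain : IsZariskiOpenIn D Set.univ
  algebraic : ∃ P : Fin 9 → MvPolynomial (Fin p) K, ∀ s k, F s k = MvPolynomial.eval s (P k)
  mem : ∀ s ∈ D, F s ∈ Fil9 K
  eq_of_isomorphic : ∀ s ∈ D, ∀ s' ∈ D, IsIsomorphic (mu (F s)) (mu (F s')) → s = s'
  isOpen_orbit : IsZariskiOpenIn (orbit (F '' D)) (Fil9 K)

/-- The Chevalley-Eilenberg coboundary
`(δ_μ f)(x, y) = μ (f x, y) + μ (x, f y) - f (μ (x, y))` of endomorphisms. -/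
def coboundary (μ : Bilin K) : Module.End K (Fin 9 → K) →ₗ[K] Bilin K where
  toFun f := μ.compl₁₂ f LinearMap.id + μ.compl₁₂ LinearMap.id f - μ.compr₂ f
  map_add' f g := by
    refine LinearMap.ext fun x => LinearMap.ext fun y => ?_
    simp only [LinearMap.sub_apply, LinearMap.add_apply, LinearMap.compl₁₂_apply,
      LinearMap.compr₂_apply, LinearMap.id_apply, map_add]
    abel
  map_smul' r f := by
    refine LinearMap.ext fun x => LinearMap.ext fun y => ?_
    simp only [LinearMap.sub_apply, LinearMap.add_apply, LinearMap.compl₁₂_apply,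
      LinearMap.compr₂_apply, LinearMap.id_apply, LinearMap.smul_apply, map_smul,
      RingHom.id_apply, smul_sub, smul_add]

/-- The linearization at `a` of (one half of) the equation of `Fil_9`. -/
def tangentForm (a : Fin 9 → K) : (Fin 9 → K) →ₗ[K] K :=
  let a2 := a 0
  let a4 := a 1
  let a6 := a 3
  a6 • LinearMap.proj 0 + (a6 / 2 - 3 * a4) • LinearMap.proj 1
    + (2 * a6 + a2 + a4 / 2) • LinearMap.proj 3

/-- The space `Z²_CR(μ_a, μ_a)`: the cochains `φ_u` with
`u_2 a_6 + u_4 (a_6 / 2 - 3 a_4) + u_6 (2 a_6 + a_2 + a_4 / 2) = 0`. -/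
def Z2CR (a : Fin 9 → K) : Submodule K (Bilin K) :=
  (LinearMap.ker (tangentForm a)).map cochain

/-- The space `B²_CR(μ_a, μ_a)`: the coboundaries `δ f`, `f ∈ gl(9, K)`, that belong to
`Z²_CR(μ_a, μ_a)`. -/
def B2CR (a : Fin 9 → K) : Submodule K (Bilin K) :=
  Z2CR a ⊓ LinearMap.range (coboundary (mu a))

/-- The restricted cohomology space `H²_CR(μ_a, μ_a) = Z²_CR / B²_CR`. -/
abbrev H2CR (a : Fin 9 → K) : Type _ := ↥(Z2CR a) ⧸ (B2CR a).submoduleOf (Z2CR a)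

variable (K) in
/-- The domain of the parameters `(t, u) = (s 0, s 1)`: `t ≠ 0, -1, -1/2`. -/
def familyDomain : Set (Fin 2 → K) :=
  {s | s 0 ≠ 0 ∧ s 0 ≠ -1 ∧ s 0 ≠ -1 / 2}

/-- The member with parameters `(t, u) = (s 0, s 1)` of the family: `a_2 = (3t² - t - 2) / 2`,
`a_4 = t`, `a_5 = 1`, `a_6 = 1`, `a_7 = 0`, `a_8 = u`, `a_9 = a_10 = a_11 = 0`. -/
def family (s : Fin 2 → K) : Fin 9 → K :=
  let t := s 0
  let u := s 1
  ![(3 * t ^ 2 - t - 2) / 2, t, 1, 1, 0, u, 0, 0, 0]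

end Filiform9

/-!
The algebras `μ_a` are compared through adapted bases. If `Y_0`, `Y_1` are suitable vectors and
`Y_{i+1} = [Y_0, Y_i]`, then in the basis `Y_0, …, Y_8` the bracket has again the form `μ_b`, so the
isomorphism problem is the study of the changes of parameters caused by a choice of `Y_0` and
`Y_1`. Call `a_2, a_4, a_6` the parameters of weight zero, `a_5, a_7` those of weight one, `a_8, a_9`
those of weight two, and `a_10`, `a_11` those of weight three and four. Up to automorphisms, four
kinds of changes matter.

* The scalings `X_0 ↦ α X_0`, `X_1 ↦ β X_1` multiply the parameters of weight `k` by
  `β / α ^ (k + 2)`.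
* The shear `X_0 ↦ X_0 + b X_1` fixes the weight zero and translates `(a_5, a_7)` by a multiple of
  a vector depending on the weight zero; `relInvariant` is the resulting linear form in
  `(a_5, a_7)` that is preserved.
* `X_1 ↦ X_1 + c X_3` fixes the weights zero and one, and translates `(a_8, a_9)` by a multiple of
  `(a_4, a_6)`.
* `X_1 ↦ X_1 + c X_4` and `X_1 ↦ X_1 + c X_5` fix the lower weights, and translate `a_10` and `a_11`
  by multiples of `a_4 + a_6` and of `2 a_4 + a_6`.

If `a_4`, `a_6`, `a_4 + a_6`, `2 a_4 + a_6` and `relInvariant` do not vanish, these changes bring `a`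
to a unique point of the family (`exists_isIsomorphic_family`): `a_6 = a_5 = 1` by scalings,
`a_7 = 0` by a shear, `a_9 = a_10 = a_11 = 0` by the remaining changes, and the equation of `Fil_9`
expresses `a_2` in terms of `t = a_4`. Conversely, comparing coordinates of low weight under an
arbitrary isomorphism (`IsIsomorphic.relations`) shows that these nonvanishing conditions are
invariant and that `t` and `u` are invariants of the members. So the orbit of the family is the
complement in `Fil_9` of one hypersurface (`orbit_family`), and it is dense because `Fil_9`, a cone
over a rational conic times an affine space, is the image of an affine space under a polynomial map.

For the cohomology, the same changes at first order give six vectors (`tangentVectors`) whose span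
contains the parameters of all the coboundaries of the form `φ_u`, at every point of `Fil_9`. Since
`dim Z²_CR ≥ 8`, it follows that `dim H²_CR ≥ 2`. At the members of the family `dim Z²_CR = 8`, and
the six vectors are independent and all come from coboundaries, so that equality holds there.
-/

namespace Filiform9

variable {K : Type*} [Field K]

/-! ### Coordinates of the brackets -/

theorem altBilin_apply_coord (c : Fin 9 → Fin 9 → Fin 9 → K) (x y : Fin 9 → K) (k : Fin 9) :
    altBilin c x y k =
      ∑ i, ∑ j, if i < j then (x i * y j - x j * y i) * c i j k else 0 := by
  simp only [altBilin, LinearMap.mk₂_apply, Finset.sum_apply]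
  refine Finset.sum_congr rfl fun i _ => Finset.sum_congr rfl fun j _ => ?_
  split_ifs <;> simp

theorem cochain_apply (u x y : Fin 9 → K) :
    cochain u x y = ![0, 0, 0, 0,
      (u 0 + 3 * u 1 + 2 * u 3) * (x 1 * y 2 - x 2 * y 1),
      (u 0 + 3 * u 1 + 2 * u 3) * (x 1 * y 3 - x 3 * y 1)
        + (u 2 + 2 * u 4) * (x 1 * y 2 - x 2 * y 1),
      (u 0 + 2 * u 1 + u 3) * (x 1 * y 4 - x 4 * y 1)
        + (u 1 + u 3) * (x 2 * y 3 - x 3 * y 2)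
        + (u 2 + 2 * u 4) * (x 1 * y 3 - x 3 * y 1)
        + (u 5 + u 6) * (x 1 * y 2 - x 2 * y 1),
      (u 0 + u 1) * (x 1 * y 5 - x 5 * y 1)
        + (u 1 + u 3) * (x 2 * y 4 - x 4 * y 2)
        + (u 2 + u 4) * (x 1 * y 4 - x 4 * y 1)
        + u 4 * (x 2 * y 3 - x 3 * y 2)
        + (u 5 + u 6) * (x 1 * y 3 - x 3 * y 1)
        + u 7 * (x 1 * y 2 - x 2 * y 1),
      u 0 * (x 1 * y 6 - x 6 * y 1) + u 1 * (x 2 * y 5 - x 5 * y 2)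
        + u 3 * (x 3 * y 4 - x 4 * y 3)
        + u 2 * (x 1 * y 5 - x 5 * y 1) + u 4 * (x 2 * y 4 - x 4 * y 2)
        + u 5 * (x 1 * y 4 - x 4 * y 1) + u 6 * (x 2 * y 3 - x 3 * y 2)
        + u 7 * (x 1 * y 3 - x 3 * y 1)
        + u 8 * (x 1 * y 2 - x 2 * y 1)] := by
  ext k
  change altBilin (table u) x y k = _
  rw [altBilin_apply_coord]
  simp only [Fin.sum_univ_succ, Fin.sum_univ_zero]
  fin_cases k <;> simp [table, X] <;> ring

theorem model_apply (x y : Fin 9 → K) :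
    model x y = ![0, 0, x 0 * y 1 - x 1 * y 0, x 0 * y 2 - x 2 * y 0, x 0 * y 3 - x 3 * y 0,
      x 0 * y 4 - x 4 * y 0, x 0 * y 5 - x 5 * y 0, x 0 * y 6 - x 6 * y 0,
      x 0 * y 7 - x 7 * y 0] := by
  ext k
  rw [model, altBilin_apply_coord]
  simp only [Fin.sum_univ_succ, Fin.sum_univ_zero]
  fin_cases k <;> simp [X, Fin.ext_iff, Fin.le_def]

theorem mu_apply (a x y : Fin 9 → K) :
    mu a x y = ![0, 0,
      x 0 * y 1 - x 1 * y 0,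
      x 0 * y 2 - x 2 * y 0,
      x 0 * y 3 - x 3 * y 0 + (a 0 + 3 * a 1 + 2 * a 3) * (x 1 * y 2 - x 2 * y 1),
      x 0 * y 4 - x 4 * y 0 + (a 0 + 3 * a 1 + 2 * a 3) * (x 1 * y 3 - x 3 * y 1)
        + (a 2 + 2 * a 4) * (x 1 * y 2 - x 2 * y 1),
      x 0 * y 5 - x 5 * y 0 + (a 0 + 2 * a 1 + a 3) * (x 1 * y 4 - x 4 * y 1)
        + (a 1 + a 3) * (x 2 * y 3 - x 3 * y 2)
        + (a 2 + 2 * a 4) * (x 1 * y 3 - x 3 * y 1)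
        + (a 5 + a 6) * (x 1 * y 2 - x 2 * y 1),
      x 0 * y 6 - x 6 * y 0 + (a 0 + a 1) * (x 1 * y 5 - x 5 * y 1)
        + (a 1 + a 3) * (x 2 * y 4 - x 4 * y 2)
        + (a 2 + a 4) * (x 1 * y 4 - x 4 * y 1)
        + a 4 * (x 2 * y 3 - x 3 * y 2)
        + (a 5 + a 6) * (x 1 * y 3 - x 3 * y 1)
        + a 7 * (x 1 * y 2 - x 2 * y 1),
      x 0 * y 7 - x 7 * y 0 + a 0 * (x 1 * y 6 - x 6 * y 1) + a 1 * (x 2 * y 5 - x 5 * y 2)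
        + a 3 * (x 3 * y 4 - x 4 * y 3)
        + a 2 * (x 1 * y 5 - x 5 * y 1) + a 4 * (x 2 * y 4 - x 4 * y 2)
        + a 5 * (x 1 * y 4 - x 4 * y 1) + a 6 * (x 2 * y 3 - x 3 * y 2)
        + a 7 * (x 1 * y 3 - x 3 * y 1)
        + a 8 * (x 1 * y 2 - x 2 * y 1)] := by
  rw [mu, LinearMap.add_apply, LinearMap.add_apply, cochain_apply, model_apply]
  ext k
  fin_cases k <;> simp <;> ring

theorem mu_eq_iff {a x y v : Fin 9 → K} : mu a x y = v ↔
    0 = v 0 ∧ 0 = v 1 ∧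
    x 0 * y 1 - x 1 * y 0 = v 2 ∧
    x 0 * y 2 - x 2 * y 0 = v 3 ∧
    x 0 * y 3 - x 3 * y 0 + (a 0 + 3 * a 1 + 2 * a 3) * (x 1 * y 2 - x 2 * y 1) = v 4 ∧
    x 0 * y 4 - x 4 * y 0 + (a 0 + 3 * a 1 + 2 * a 3) * (x 1 * y 3 - x 3 * y 1)
      + (a 2 + 2 * a 4) * (x 1 * y 2 - x 2 * y 1) = v 5 ∧
    x 0 * y 5 - x 5 * y 0 + (a 0 + 2 * a 1 + a 3) * (x 1 * y 4 - x 4 * y 1)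
      + (a 1 + a 3) * (x 2 * y 3 - x 3 * y 2)
      + (a 2 + 2 * a 4) * (x 1 * y 3 - x 3 * y 1)
      + (a 5 + a 6) * (x 1 * y 2 - x 2 * y 1) = v 6 ∧
    x 0 * y 6 - x 6 * y 0 + (a 0 + a 1) * (x 1 * y 5 - x 5 * y 1)
      + (a 1 + a 3) * (x 2 * y 4 - x 4 * y 2)
      + (a 2 + a 4) * (x 1 * y 4 - x 4 * y 1)
      + a 4 * (x 2 * y 3 - x 3 * y 2)
      + (a 5 + a 6) * (x 1 * y 3 - x 3 * y 1)
      + a 7 * (x 1 * y 2 - x 2 * y 1) = v 7 ∧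
    x 0 * y 7 - x 7 * y 0 + a 0 * (x 1 * y 6 - x 6 * y 1) + a 1 * (x 2 * y 5 - x 5 * y 2)
      + a 3 * (x 3 * y 4 - x 4 * y 3)
      + a 2 * (x 1 * y 5 - x 5 * y 1) + a 4 * (x 2 * y 4 - x 4 * y 2)
      + a 5 * (x 1 * y 4 - x 4 * y 1) + a 6 * (x 2 * y 3 - x 3 * y 2)
      + a 7 * (x 1 * y 3 - x 3 * y 1)
      + a 8 * (x 1 * y 2 - x 2 * y 1) = v 8 := by
  rw [mu_apply]
  constructor
  · rintro rfl
    exact ⟨rfl, rfl, rfl, rfl, rfl, rfl, rfl, rfl, rfl⟩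
  · rintro ⟨h0, h1, h2, h3, h4, h5, h6, h7, h8⟩
    ext k
    fin_cases k <;> assumption

theorem altBilin_swap (c : Fin 9 → Fin 9 → Fin 9 → K) (x y : Fin 9 → K) :
    altBilin c x y = -altBilin c y x := by
  simp only [altBilin, LinearMap.mk₂_apply, ← Finset.sum_neg_distrib]
  refine Finset.sum_congr rfl fun i _ => Finset.sum_congr rfl fun j _ => ?_
  split_ifs
  · module
  · simp

theorem altBilin_self (c : Fin 9 → Fin 9 → Fin 9 → K) (x : Fin 9 → K) :
    altBilin c x x = 0 := by
  rw [altBilin, LinearMap.mk₂_apply]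
  refine Finset.sum_eq_zero fun i _ => Finset.sum_eq_zero fun j _ => ?_
  rw [mul_comm, sub_self, zero_smul, ite_self]

theorem altBilin_X (c : Fin 9 → Fin 9 → Fin 9 → K) {i j : Fin 9} (h : i < j) :
    altBilin c (X i) (X j) = c i j := by
  simp only [altBilin, LinearMap.mk₂_apply, X, Pi.single_apply]
  rw [Finset.sum_eq_single i, Finset.sum_eq_single j]
  · simp [h, h.ne, h.ne']
  · intro b _ hb
    simp [hb, h.ne]
  · simp
  · intro b _ hb
    refine Finset.sum_eq_zero fun d _ => ?_
    rw [if_neg hb, zero_mul, zero_sub]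
    split_ifs with h1 h2 h3 <;> simp
    exact absurd (h2 ▸ h3 ▸ h1 : j < i) h.asymm
  · simp

theorem mu_eq_altBilin_add (a x y : Fin 9 → K) :
    mu a x y = altBilin (fun i j => if i = 0 ∧ 1 ≤ j ∧ j ≤ 7 then X (j + 1) else 0) x y
      + altBilin (table a) x y := rfl

theorem mu_self (a x : Fin 9 → K) : mu a x x = 0 := by
  rw [mu_eq_altBilin_add, altBilin_self, altBilin_self, add_zero]

theorem mu_swap (a x y : Fin 9 → K) : mu a x y = -mu a y x := by
  rw [mu_eq_altBilin_add, altBilin_swap, altBilin_swap (table a), mu_eq_altBilin_add, neg_add]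

theorem mu_X_zero (a : Fin 9 → K) {j : Fin 9} (h1 : 1 ≤ j) (h7 : j ≤ 7) :
    mu a (X 0) (X j) = X (j + 1) := by
  have h : (0 : Fin 9) < j := lt_of_lt_of_le (by decide) h1
  rw [mu_eq_altBilin_add, altBilin_X _ h, altBilin_X _ h, if_pos ⟨rfl, h1, h7⟩]
  exact add_zero _

theorem mu_X_zero_X_eight (a : Fin 9 → K) : mu a (X 0) (X 8) = 0 := by
  have h : (0 : Fin 9) < 8 := by decide
  rw [mu_eq_altBilin_add, altBilin_X _ h, altBilin_X _ h, if_neg (by decide)]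
  exact add_zero _

theorem mu_X_of_lt (a : Fin 9 → K) {i j : Fin 9} (hi : 1 ≤ i) (hij : i < j) :
    mu a (X i) (X j) = table a i j := by
  have h : i ≠ 0 := by rintro rfl; exact absurd hi (by decide)
  rw [mu_eq_altBilin_add, altBilin_X _ hij, altBilin_X _ hij, if_neg fun h' => h h'.1, zero_add]

/-- Two bilinear maps that are alternating agree as soon as they agree on the pairs of basis
vectors `(X_i, X_j)` with `i < j`. -/
theorem bilin_ext_of_lt {B C : Bilin K} (hB : ∀ x y, B x y = -B y x) (hB0 : ∀ x, B x x = 0)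
    (hC : ∀ x y, C x y = -C y x) (hC0 : ∀ x, C x x = 0)
    (h : ∀ i j, i < j → B (X i) (X j) = C (X i) (X j)) : B = C := by
  refine LinearMap.ext_basis (Pi.basisFun K (Fin 9)) (Pi.basisFun K (Fin 9)) fun i j => ?_
  simp only [Pi.basisFun_apply]
  change B (X i) (X j) = C (X i) (X j)
  rcases lt_trichotomy i j with hij | rfl | hij
  · exact h i j hij
  · rw [hB0, hC0]
  · rw [hB, hC, h j i hij]

/-! ### Isomorphisms from adapted bases -/

theorem IsIsomorphic.symm {μ ν : Bilin K} : IsIsomorphic μ ν → IsIsomorphic ν μ := by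
  rintro ⟨e, he⟩
  exact ⟨e.symm, fun x y => by rw [e.symm_apply_eq, he, e.apply_symm_apply, e.apply_symm_apply]⟩

theorem IsIsomorphic.trans {μ ν ρ : Bilin K} :
    IsIsomorphic μ ν → IsIsomorphic ν ρ → IsIsomorphic μ ρ := by
  rintro ⟨e, he⟩ ⟨f, hf⟩
  exact ⟨e.trans f, fun x y => by simp only [LinearEquiv.trans_apply, he, hf]⟩

/-- The bracket of a combination of `X_i, X_{i+1}, …` with a combination of `X_j, X_{j+1}, …`
vanishes if `i + j ≥ 8`: the bracket of `X_k` and `X_l`, with `k, l ≥ 1`, is a combination of the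
`X_m` with `m ≥ k + l + 1`. -/
theorem mu_eq_zero_of_supported {a x y : Fin 9 → K} {i j : Fin 9} (hi : 1 ≤ i)
    (hij : 8 ≤ i.val + j.val) (hlt : i < j) (hx : ∀ k < i, x k = 0) (hy : ∀ k < j, y k = 0) :
    mu a x y = 0 := by
  have h0 : x 0 = 0 := hx 0 (lt_of_lt_of_le (by decide) hi)
  have h1 : y 0 = 0 := hy 0 (lt_of_lt_of_le (by decide) (hi.trans hlt.le))
  have h : ∀ k l : Fin 9, k.val + l.val ≤ 7 → x k * y l = 0 := by
    intro k l hkl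
    by_cases hk : k < i
    · rw [hx k hk, zero_mul]
    · rw [hy l (by rw [Fin.lt_def] at *; omega), mul_zero]
  ext k
  rw [mu_apply]
  fin_cases k <;> simp (discharger := decide) [h0, h1, h]

theorem table_eq_zero (u : Fin 9 → K) {i j : Fin 9} (hij : 8 ≤ i.val + j.val) :
    table u i j = 0 := by
  fin_cases i <;> fin_cases j <;> first | rfl | exact absurd hij (by decide)

/-- If a triangular sequence `Y_0, ..., Y_8` is adapted to `μ_a`, in the sense that
`[Y_0, Y_i] = Y_{i+1}`, and the brackets `[Y_i, Y_j]` are the ones prescribed by the table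
with parameters `b`, then the change of basis `X_i ↦ Y_i` is an isomorphism of `μ_b` with `μ_a`.
Only the brackets with `i + j ≤ 7` have to be checked. -/
theorem isIsomorphic_of_adapted {a b : Fin 9 → K} (Y : Matrix (Fin 9) (Fin 9) K)
    (hY : Y.BlockTriangular id) (hd : ∀ i, Y i i ≠ 0)
    (h0 : ∀ i, 1 ≤ i → i ≤ 7 → mu a (Y 0) (Y i) = Y (i + 1))
    (h : ∀ i j, 1 ≤ i → i < j → i.val + j.val ≤ 7 →
      mu a (Y i) (Y j) = Matrix.vecMul (table b i j) Y) :
    IsIsomorphic (mu b) (mu a) := by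
  have hdet : IsUnit Y := by
    rw [Matrix.isUnit_iff_isUnit_det, Matrix.det_of_isUpperTriangular hY]
    exact (Finset.prod_ne_zero_iff.2 fun i _ => hd i).isUnit
  have hX : ∀ i, Matrix.vecMul (X i) Y = Y i := fun i => Matrix.single_one_vecMul i Y
  have hsupp : ∀ i k, k < i → Y i k = 0 := fun i k hk => hY hk
  let g : (Fin 9 → K) →ₗ[K] (Fin 9 → K) := Y.vecMulLinear
  have hg : ∀ v, g v = Matrix.vecMul v Y := fun v => rfl
  let e : (Fin 9 → K) ≃ₗ[K] (Fin 9 → K) :=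
    LinearEquiv.ofInjectiveEndo g (Matrix.vecMul_injective_iff_isUnit.2 hdet)
  have he : ∀ v, e v = g v := fun v => rfl
  have key : (mu b).compr₂ g = (mu a).compl₁₂ g g := by
    refine bilin_ext_of_lt ?_ ?_ ?_ ?_ ?_
    · intro x y
      rw [LinearMap.compr₂_apply, LinearMap.compr₂_apply, mu_swap, map_neg]
    · intro x
      rw [LinearMap.compr₂_apply, mu_self, map_zero]
    · intro x y
      rw [LinearMap.compl₁₂_apply, LinearMap.compl₁₂_apply, mu_swap]
    · intro x
      rw [LinearMap.compl₁₂_apply, mu_self]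
    · intro i j hij
      rw [LinearMap.compr₂_apply, LinearMap.compl₁₂_apply, hg, hg, hg, hX, hX]
      rcases eq_or_ne i 0 with rfl | hi
      · have hj : 1 ≤ j := by rw [Fin.lt_def] at hij; rw [Fin.le_def]; exact hij
        rcases le_or_gt j 7 with hj7 | hj7
        · rw [mu_X_zero _ hj hj7, hX, h0 j hj hj7]
        · obtain rfl : j = 8 := by rw [Fin.lt_def] at hj7; ext; omega
          rw [mu_X_zero_X_eight, Matrix.zero_vecMul]
          ext k
          have h8 : ∀ k < 8, Y 8 k = 0 := hsupp 8
          rw [mu_apply]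
          fin_cases k <;> simp (discharger := decide) [h8]
      · have hi : 1 ≤ i := by
          rw [Fin.le_def]; exact Nat.one_le_iff_ne_zero.2 fun h' => hi (Fin.ext h')
        rw [mu_X_of_lt _ hi hij]
        by_cases hs : i.val + j.val ≤ 7
        · exact (h i j hi hij hs).symm
        · rw [mu_eq_zero_of_supported hi (by omega) hij (hsupp i) (hsupp j),
            table_eq_zero _ (by omega), Matrix.zero_vecMul]
  exact ⟨e, fun x y => by
    rw [he, he, he, ← LinearMap.compr₂_apply, key, LinearMap.compl₁₂_apply]⟩

theorem vecMul_table (u : Fin 9 → K) (Y : Matrix (Fin 9) (Fin 9) K) (i j : Fin 9) :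
    Matrix.vecMul (table u i j) Y = match i, j with
      | 1, 6 => u 0 • Y 8
      | 2, 5 => u 1 • Y 8
      | 1, 5 => (u 0 + u 1) • Y 7 + u 2 • Y 8
      | 3, 4 => u 3 • Y 8
      | 2, 4 => (u 1 + u 3) • Y 7 + u 4 • Y 8
      | 1, 4 => (u 0 + 2 * u 1 + u 3) • Y 6 + (u 2 + u 4) • Y 7 + u 5 • Y 8
      | 2, 3 => (u 1 + u 3) • Y 6 + u 4 • Y 7 + u 6 • Y 8
      | 1, 3 => (u 0 + 3 * u 1 + 2 * u 3) • Y 5 + (u 2 + 2 * u 4) • Y 6 + (u 5 + u 6) • Y 7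
          + u 7 • Y 8
      | 1, 2 => (u 0 + 3 * u 1 + 2 * u 3) • Y 4 + (u 2 + 2 * u 4) • Y 5 + (u 5 + u 6) • Y 6
          + u 7 • Y 7 + u 8 • Y 8
      | _, _ => 0 := by
  have hX : ∀ i, Matrix.vecMul (X i) Y = Y i := fun i => Matrix.single_one_vecMul i Y
  unfold table
  split <;> simp only [Matrix.add_vecMul, Matrix.smul_vecMul, Matrix.zero_vecMul, hX]

/-- The same criterion with the prescribed brackets written out. -/
theorem isIsomorphic_of_brackets {a b : Fin 9 → K} (Y : Matrix (Fin 9) (Fin 9) K)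
    (hY : ∀ i k, k < i → Y i k = 0) (hd : ∀ i, Y i i ≠ 0)
    (h01 : mu a (Y 0) (Y 1) = Y 2) (h02 : mu a (Y 0) (Y 2) = Y 3)
    (h03 : mu a (Y 0) (Y 3) = Y 4) (h04 : mu a (Y 0) (Y 4) = Y 5)
    (h05 : mu a (Y 0) (Y 5) = Y 6) (h06 : mu a (Y 0) (Y 6) = Y 7)
    (h07 : mu a (Y 0) (Y 7) = Y 8)
    (h16 : mu a (Y 1) (Y 6) = b 0 • Y 8)
    (h25 : mu a (Y 2) (Y 5) = b 1 • Y 8)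
    (h15 : mu a (Y 1) (Y 5) = (b 0 + b 1) • Y 7 + b 2 • Y 8)
    (h34 : mu a (Y 3) (Y 4) = b 3 • Y 8)
    (h24 : mu a (Y 2) (Y 4) = (b 1 + b 3) • Y 7 + b 4 • Y 8)
    (h14 : mu a (Y 1) (Y 4) = (b 0 + 2 * b 1 + b 3) • Y 6 + (b 2 + b 4) • Y 7 + b 5 • Y 8)
    (h23 : mu a (Y 2) (Y 3) = (b 1 + b 3) • Y 6 + b 4 • Y 7 + b 6 • Y 8)
    (h13 : mu a (Y 1) (Y 3) = (b 0 + 3 * b 1 + 2 * b 3) • Y 5 + (b 2 + 2 * b 4) • Y 6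
      + (b 5 + b 6) • Y 7 + b 7 • Y 8)
    (h12 : mu a (Y 1) (Y 2) = (b 0 + 3 * b 1 + 2 * b 3) • Y 4 + (b 2 + 2 * b 4) • Y 5
      + (b 5 + b 6) • Y 6 + b 7 • Y 7 + b 8 • Y 8) :
    IsIsomorphic (mu b) (mu a) := by
  refine isIsomorphic_of_adapted Y (fun i k hk => hY i k hk) hd ?_ ?_
  · intro i h1 h7
    fin_cases i <;> first
      | exact absurd h1 (by decide)
      | exact absurd h7 (by decide)
      | skip
    exacts [h01, h02, h03, h04, h05, h06, h07]
  · intro i j hi hij hs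
    rw [vecMul_table]
    fin_cases i <;> fin_cases j <;> first
      | exact absurd hi (by decide)
      | exact absurd hij (by decide)
      | exact absurd hs (by decide)
      | skip
    exacts [h12, h13, h14, h15, h16, h23, h24, h25, h34]

/-! ### Normal forms -/

section

/-- The change of basis `X_0 ↦ α X_0`, `X_1 ↦ β X_1`. -/
theorem isIsomorphic_scale (a : Fin 9 → K) {α β : K} (hα : α ≠ 0) (hβ : β ≠ 0) :
    IsIsomorphic (mu ![β / α ^ 2 * a 0, β / α ^ 2 * a 1, β / α ^ 3 * a 2, β / α ^ 2 * a 3,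
      β / α ^ 3 * a 4, β / α ^ 4 * a 5, β / α ^ 4 * a 6, β / α ^ 5 * a 7, β / α ^ 6 * a 8])
      (mu a) := by
  refine isIsomorphic_of_brackets (Matrix.of
    ![![α, 0, 0, 0, 0, 0, 0, 0, 0], ![0, β, 0, 0, 0, 0, 0, 0, 0],
      ![0, 0, α * β, 0, 0, 0, 0, 0, 0], ![0, 0, 0, α ^ 2 * β, 0, 0, 0, 0, 0],
      ![0, 0, 0, 0, α ^ 3 * β, 0, 0, 0, 0], ![0, 0, 0, 0, 0, α ^ 4 * β, 0, 0, 0],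
      ![0, 0, 0, 0, 0, 0, α ^ 5 * β, 0, 0], ![0, 0, 0, 0, 0, 0, 0, α ^ 6 * β, 0],
      ![0, 0, 0, 0, 0, 0, 0, 0, α ^ 7 * β]])
    ?_ ?_ ?_ ?_ ?_ ?_ ?_ ?_ ?_ ?_ ?_ ?_ ?_ ?_ ?_ ?_
    ?_ ?_
  · intro i k hk
    fin_cases i <;> fin_cases k <;> first | rfl | exact absurd hk (by decide)
  · intro i
    fin_cases i <;> simp [hα, hβ]
  all_goals
    rw [mu_eq_iff]
    simp only [Matrix.of_apply, Matrix.cons_val, Pi.add_apply, Pi.smul_apply,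
      smul_eq_mul]
    refine ⟨?_, ?_, ?_, ?_, ?_, ?_, ?_, ?_, ?_⟩ <;> first | trivial | ring1 | field

variable [CharZero K]

/-- The point of `Fil_9` with `a_6 = 1` and prescribed remaining parameters; the equation of
`Fil_9` then determines `a_2`. -/
def unitPoint (t a5 a7 a8 a9 a10 a11 : K) : Fin 9 → K :=
  ![(3 * t ^ 2 - t - 2) / 2, t, a5, 1, a7, a8, a9, a10, a11]

/-- The change of basis `X_1 ↦ X_1 + c_3 X_3 + c_4 X_4 + c_5 X_5`. -/
theorem isIsomorphic_unitPoint_shift (t a5 a7 a8 a9 a10 a11 c3 c4 c5 : K) :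
    IsIsomorphic
      (mu (unitPoint t a5 a7 (a8 - 2 * c3 * t) (a9 - 2 * c3)
        (a10 - 2 * a7 * c3 - 3 * (t + 1) * c4)
        (a11 - 2 * a9 * c3 + (2 * t + 3) * c3 ^ 2 - 3 * a7 * c4 - 2 * (2 * t + 1) * c5)))
      (mu (unitPoint t a5 a7 a8 a9 a10 a11)) := by
  refine isIsomorphic_of_brackets (Matrix.of
    ![![1, 0, 0, 0, 0, 0, 0, 0, 0], ![0, 1, 0, c3, c4, c5, 0, 0, 0],
      ![0, 0, 1, 0, c3, c4, c5, 0, 0], ![0, 0, 0, 1, 0, c3, c4, c5, 0],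
      ![0, 0, 0, 0, 1, 0, c3, c4, c5], ![0, 0, 0, 0, 0, 1, 0, c3, c4],
      ![0, 0, 0, 0, 0, 0, 1, 0, c3], ![0, 0, 0, 0, 0, 0, 0, 1, 0],
      ![0, 0, 0, 0, 0, 0, 0, 0, 1]])
    ?_ ?_ ?_ ?_ ?_ ?_ ?_ ?_ ?_ ?_ ?_ ?_ ?_ ?_ ?_ ?_ ?_ ?_
  · intro i k hk
    fin_cases i <;> fin_cases k <;> first | rfl | exact absurd hk (by decide)
  · intro i
    fin_cases i <;> simp
  all_goals
    rw [mu_eq_iff]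
    simp only [unitPoint, Matrix.of_apply, Matrix.cons_val, Pi.add_apply, Pi.smul_apply,
      smul_eq_mul]
    refine ⟨?_, ?_, ?_, ?_, ?_, ?_, ?_, ?_, ?_⟩ <;> first | trivial | ring1

set_option maxHeartbeats 400000 in
/-- The change of basis `X_0 ↦ X_0 + b X_1`, applied to a point with `a_7 = a_9 = a_10 = a_11 = 0`.
It moves `a_7` by a multiple of `t (t + 1) ^ 2`, and translates `a_8` and `a_9` by amounts that do
not depend on `a_8`. -/
theorem exists_isIsomorphic_unitPoint_shear (t a5 b : K) : ∃ c a9 : K, ∀ u, ∃ a10 a11 : K,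
    IsIsomorphic
      (mu (unitPoint t (a5 - (9 * t ^ 4 + 12 * t ^ 3 + t ^ 2 + 2 * t + 4) * b / 2)
        (-(9 * t * (t + 1) ^ 2 / 2 * b)) (u + c) a9 a10 a11))
      (mu (unitPoint t a5 0 u 0 0 0)) := by
  refine ⟨-(15 * t ^ 2 + 17 * t) * a5 * b / 2 + (135 * t ^ 6 + 495 * t ^ 5 + 831 * t ^ 4
      + 857 * t ^ 3 + 526 * t ^ 2 + 140 * t) * b ^ 2 / 8,
    -(3 * t + 4) * a5 * b + (81 * t ^ 5 + 243 * t ^ 4 + 267 * t ^ 3 + 145 * t ^ 2 + 56 * t + 16)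
      * b ^ 2 / 4, fun u =>
    ⟨3 * (63 * t ^ 4 + 186 * t ^ 3 + 199 * t ^ 2 + 92 * t + 16) * a5 * b ^ 2 / 4
      - 3 * a5 ^ 2 * b - 3 * (3 * t ^ 2 + 4 * t + 1) * u * b
      - (567 * t ^ 8 + 3537 * t ^ 7 + 9558 * t ^ 6 + 14622 * t ^ 5 + 13867 * t ^ 4
        + 8365 * t ^ 3 + 3144 * t ^ 2 + 676 * t + 64) * b ^ 3 / 8,
    -7 * a5 * u * b - (1134 * t ^ 6 + 4797 * t ^ 5 + 8322 * t ^ 4 + 7631 * t ^ 3 + 3942 * t ^ 2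
        + 1098 * t + 128) * a5 * b ^ 3 / 4
      + (42 * t ^ 2 + 56 * t + 15) * a5 ^ 2 * b ^ 2
      + (126 * t ^ 4 + 321 * t ^ 3 + 290 * t ^ 2 + 115 * t + 20) * u * b ^ 2 / 2
      + (5103 * t ^ 10 + 37989 * t ^ 9 + 126495 * t ^ 8 + 248562 * t ^ 7 + 319965 * t ^ 6
        + 282709 * t ^ 5 + 174089 * t ^ 4 + 73900 * t ^ 3 + 20692 * t ^ 2 + 3440 * t + 256)
        * b ^ 4 / 16, ?_⟩⟩
  refine isIsomorphic_of_brackets (Matrix.of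
    ![![1, b, 0, 0, 0, 0, 0, 0, 0],
      ![0, 1, 0, 0, 0, 0, 0, 0, 0],
      ![0, 0, 1, 0, 0, 0, 0, 0, 0],
      ![0, 0, 0, 1, (3 * t ^ 2 + 5 * t + 2) * b / 2, a5 * b, u * b, 0, 0],
      ![0, 0, 0, 0, 1, (3 * t ^ 2 + 5 * t + 2) * b,
        2 * a5 * b + 3 * (3 * t ^ 4 + 8 * t ^ 3 + 7 * t ^ 2 + 2 * t) * b ^ 2 / 4,
        3 * (t ^ 2 + t) * a5 * b ^ 2 + 2 * u * b,
        a5 ^ 2 * b ^ 2 + (3 * t ^ 2 + 2 * t) * u * b ^ 2],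
      ![0, 0, 0, 0, 0, 1, (9 * t ^ 2 + 13 * t + 4) * b / 2,
        3 * a5 * b + (27 * t ^ 4 + 60 * t ^ 3 + 31 * t ^ 2 - 10 * t - 8) * b ^ 2 / 4,
        (9 * t ^ 2 + 7 * t) * a5 * b ^ 2 + 3 * u * b
          + 3 * (9 * t ^ 6 + 21 * t ^ 5 + 7 * t ^ 4 - 17 * t ^ 3 - 16 * t ^ 2 - 4 * t)
            * b ^ 3 / 8],
      ![0, 0, 0, 0, 0, 0, 1, (6 * t ^ 2 + 7 * t + 1) * b,
        4 * a5 * b + (27 * t ^ 4 + 45 * t ^ 3 + 6 * t ^ 2 - 20 * t - 8) * b ^ 2 / 2],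
      ![0, 0, 0, 0, 0, 0, 0, 1, (15 * t ^ 2 + 13 * t) * b / 2],
      ![0, 0, 0, 0, 0, 0, 0, 0, 1]])
    ?_ ?_ ?_ ?_ ?_ ?_ ?_ ?_ ?_ ?_ ?_ ?_ ?_ ?_ ?_ ?_ ?_ ?_
  · intro i k hk
    fin_cases i <;> fin_cases k <;> first | rfl | exact absurd hk (by decide)
  · intro i
    fin_cases i <;> simp
  all_goals
    rw [mu_eq_iff]
    simp only [unitPoint, Matrix.of_apply, Matrix.cons_val, Pi.add_apply, Pi.smul_apply,
      smul_eq_mul]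
    refine ⟨?_, ?_, ?_, ?_, ?_, ?_, ?_, ?_, ?_⟩ <;> first | trivial | ring1

/-- The form `p a_5 - q a_7`, where `p` and `q` are quadratic forms in `a_2, a_4, a_6` such that on
`Fil_9` the change of basis `X_0 ↦ X_0 + b X_1` acts by `a_5 ↦ a_5 - q b` and `a_7 ↦ a_7 - p b`.
Hence this change of basis does not move it, and isomorphisms only multiply it by nonzero
factors. -/
def relInvariant {R : Type*} [CommRing R] (a : Fin 9 → R) : R :=
  (3 * a 0 * a 1 + 5 * a 0 * a 3 + 10 * a 1 * a 3 + 3 * a 1 ^ 2 + 5 * a 3 ^ 2) * a 2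
    - (2 * a 0 ^ 2 + 6 * a 0 * a 1 + 5 * a 1 * a 3 + 9 * a 1 ^ 2) * a 4

/-- The polynomial function whose nonvanishing characterizes the algebras of `Fil_9` that are
isomorphic to a member of the family. -/
def genericity {R : Type*} [CommRing R] (a : Fin 9 → R) : R :=
  a 1 * a 3 * (a 1 + a 3) * (2 * a 1 + a 3) * relInvariant a

theorem relInvariant_unitPoint (t a5 a7 a8 a9 a10 a11 : K) :
    relInvariant (unitPoint t a5 a7 a8 a9 a10 a11) =
      9 * t * (t + 1) ^ 2 / 2 * a5
        - (9 * t ^ 4 + 12 * t ^ 3 + t ^ 2 + 2 * t + 4) / 2 * a7 := by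
  simp only [relInvariant, unitPoint, Matrix.cons_val]
  ring

omit [CharZero K] in
theorem family_eq_unitPoint (s : Fin 2 → K) : family s = unitPoint (s 0) 1 0 (s 1) 0 0 0 := rfl

theorem unitPoint_mem_Fil9 (t a5 a7 a8 a9 a10 a11 : K) :
    unitPoint t a5 a7 a8 a9 a10 a11 ∈ Fil9 K := by
  simp only [Fil9, Set.mem_ofPred_eq, unitPoint, Matrix.cons_val]
  ring

/-- A shear kills `a_7`, and then a shift kills `a_9`, `a_10` and `a_11`. The isomorphism is
constructed in the opposite direction: the parameter `u` of the target is free, and is used to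
match `a_8`. -/
theorem exists_isIsomorphic_unitPoint_zero {t : K} (ht : t ≠ 0) (ht1 : t + 1 ≠ 0)
    (ht2 : 2 * t + 1 ≠ 0) {a5 a7 a8 a9 a10 a11 : K}
    (h : relInvariant (unitPoint t a5 a7 a8 a9 a10 a11) ≠ 0) :
    ∃ v u : K, v ≠ 0 ∧
      IsIsomorphic (mu (unitPoint t a5 a7 a8 a9 a10 a11)) (mu (unitPoint t v 0 u 0 0 0)) := by
  rw [relInvariant_unitPoint] at h
  -- the value for which the shear produces the given `a_7`
  set b := -(2 * a7 / (9 * t * (t + 1) ^ 2)) with hb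
  set v := a5 + (9 * t ^ 4 + 12 * t ^ 3 + t ^ 2 + 2 * t + 4) * b / 2 with hv
  obtain ⟨c, b9, hc⟩ := exists_isIsomorphic_unitPoint_shear t v b
  obtain ⟨b10, b11, hiso⟩ := hc (a8 - c + (b9 - a9) * t)
  have hbv : v - (9 * t ^ 4 + 12 * t ^ 3 + t ^ 2 + 2 * t + 4) * b / 2 = a5 := by rw [hv]; ring
  have hb7 : -(9 * t * (t + 1) ^ 2 / 2 * b) = a7 := by rw [hb]; field
  rw [hbv, hb7] at hiso
  have hc3 := isIsomorphic_unitPoint_shift t a5 a7 (a8 - c + (b9 - a9) * t + c) b9 b10 b11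
    ((b9 - a9) / 2) ((b10 - 2 * a7 * ((b9 - a9) / 2) - a10) / (3 * (t + 1)))
    ((b11 - 2 * b9 * ((b9 - a9) / 2) + (2 * t + 3) * ((b9 - a9) / 2) ^ 2
      - 3 * a7 * ((b10 - 2 * a7 * ((b9 - a9) / 2) - a10) / (3 * (t + 1))) - a11)
      / (2 * (2 * t + 1)))
  refine ⟨v, _, ?_, IsIsomorphic.trans ?_ hiso⟩
  · intro h0
    apply h
    rw [h0] at hbv
    rw [← hbv, ← hb7]
    ring
  · convert hc3 using 3
    · ring
    · ring
    · field
    · field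

/-- The scaling that makes `a_5` equal to `1` and preserves the parameters of weight zero. -/
theorem isIsomorphic_family_of_unitPoint {t v : K} (hv : v ≠ 0) (u : K) :
    IsIsomorphic (mu (unitPoint t v 0 u 0 0 0)) (mu (family ![t, u / v ^ 2])) := by
  have h := (isIsomorphic_scale (unitPoint t v 0 u 0 0 0) hv (pow_ne_zero 2 hv)).symm
  convert h using 2
  rw [family_eq_unitPoint]
  ext k
  fin_cases k <;> simp [unitPoint] <;> field

/-- The scaling of `X_1` that makes `a_6` equal to `1`. -/
theorem isIsomorphic_unitPoint_of_mem_Fil9 {a : Fin 9 → K} (ha : a ∈ Fil9 K) (h3 : a 3 ≠ 0) :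
    IsIsomorphic (mu a) (mu (unitPoint (a 1 / a 3) (a 2 / a 3) (a 4 / a 3) (a 5 / a 3)
      (a 6 / a 3) (a 7 / a 3) (a 8 / a 3))) := by
  have h := (isIsomorphic_scale a one_ne_zero (inv_ne_zero h3)).symm
  convert h using 2
  have ha' : -3 * (a 1) ^ 2 + 2 * (a 3) ^ 2 + 2 * a 0 * a 3 + a 1 * a 3 = 0 := ha
  ext k
  fin_cases k <;> simp [unitPoint] <;> field_simp
  linear_combination -ha'

/-- Every algebra of `Fil_9` at which `genericity` does not vanish belongs to the orbit of the
family. -/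
theorem exists_isIsomorphic_family {a : Fin 9 → K} (ha : a ∈ Fil9 K) (hg : genericity a ≠ 0) :
    ∃ s ∈ familyDomain K, IsIsomorphic (mu a) (mu (family s)) := by
  simp only [genericity, mul_ne_zero_iff] at hg
  obtain ⟨⟨⟨⟨h1, h3⟩, h13⟩, h213⟩, hI⟩ := hg
  have hs : a 1 / a 3 + 1 ≠ 0 := by
    rw [div_add_one h3]; exact div_ne_zero h13 h3
  have hs2 : 2 * (a 1 / a 3) + 1 ≠ 0 := by
    rw [← mul_div_assoc, div_add_one h3]; exact div_ne_zero h213 h3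
  have ha' : -3 * (a 1) ^ 2 + 2 * (a 3) ^ 2 + 2 * a 0 * a 3 + a 1 * a 3 = 0 := ha
  have h0 : (3 * (a 1 / a 3) ^ 2 - a 1 / a 3 - 2) / 2 = a 0 / a 3 := by
    field_simp
    linear_combination -ha'
  obtain ⟨v, u, hv, hiso⟩ := exists_isIsomorphic_unitPoint_zero (div_ne_zero h1 h3) hs hs2
    (a5 := a 2 / a 3) (a7 := a 4 / a 3) (a8 := a 5 / a 3) (a9 := a 6 / a 3) (a10 := a 7 / a 3)
    (a11 := a 8 / a 3) (by
      have : relInvariant (unitPoint (a 1 / a 3) (a 2 / a 3) (a 4 / a 3) (a 5 / a 3)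
          (a 6 / a 3) (a 7 / a 3) (a 8 / a 3)) = relInvariant a / a 3 ^ 3 := by
        simp only [relInvariant, unitPoint, h0, Matrix.cons_val]
        field
      rw [this]
      exact div_ne_zero hI (pow_ne_zero 3 h3))
  refine ⟨![a 1 / a 3, u / v ^ 2], ⟨div_ne_zero h1 h3, ?_, ?_⟩,
    (isIsomorphic_unitPoint_of_mem_Fil9 ha h3).trans
      (hiso.trans (isIsomorphic_family_of_unitPoint hv u))⟩
  · intro h
    have h' : a 1 / a 3 = -1 := h
    exact hs (by rw [h']; norm_num)
  · intro h
    have h' : a 1 / a 3 = -1 / 2 := h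
    exact hs2 (by rw [h']; norm_num)

end

/-! ### Invariants of isomorphisms -/

/-- Let `x`, `y`, `z_2 = [x, y]` and `z_{i+1} = [x, z_i]` be the images of `X_0, …, X_8` under an
isomorphism onto `μ_b`. The vector `z_i` has no components before `X_i`, so that the
condition `z_8 ≠ 0` makes the leading coordinates of `x` and `y` nonzero, while `[y, z_7] = 0` forces
`y` into the span of `X_1, …, X_8`. -/
theorem adapted_leading {b x y z2 z3 z4 z5 z6 z7 z8 : Fin 9 → K}
    (h2 : mu b x y = z2) (h3 : mu b x z2 = z3) (h4 : mu b x z3 = z4) (h5 : mu b x z4 = z5)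
    (h6 : mu b x z5 = z6) (h7 : mu b x z6 = z7) (h8 : mu b x z7 = z8) (hy : mu b y z7 = 0)
    (hz : z8 ≠ 0) : x 0 ≠ 0 ∧ y 0 = 0 ∧ y 1 ≠ 0 := by
  obtain ⟨a0, a1, a2, -⟩ := mu_eq_iff.1 h2
  obtain ⟨b0, b1, b2, b3, -⟩ := mu_eq_iff.1 h3
  simp only [← a0, ← a1, mul_zero, sub_zero] at b2 b3
  obtain ⟨c0, c1, c2, c3, c4, -⟩ := mu_eq_iff.1 h4
  simp only [← b0, ← b1, ← b2, mul_zero, sub_zero, add_zero] at c2 c3 c4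
  obtain ⟨d0, d1, d2, d3, d4, d5, -⟩ := mu_eq_iff.1 h5
  simp only [← c0, ← c1, ← c2, ← c3, mul_zero, sub_zero, add_zero] at d2 d3 d4 d5
  obtain ⟨e0, e1, e2, e3, e4, e5, e6, -⟩ := mu_eq_iff.1 h6
  simp only [← d0, ← d1, ← d2, ← d3, ← d4, mul_zero, sub_zero, add_zero] at e2 e3 e4 e5 e6
  obtain ⟨f0, f1, f2, f3, f4, f5, f6, f7, -⟩ := mu_eq_iff.1 h7
  simp only [← e0, ← e1, ← e2, ← e3, ← e4, ← e5, mul_zero, sub_zero, add_zero]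
    at f2 f3 f4 f5 f6 f7
  obtain ⟨g0, g1, g2, g3, g4, g5, g6, g7, g8⟩ := mu_eq_iff.1 h8
  simp only [← f0, ← f1, ← f2, ← f3, ← f4, ← f5, ← f6, mul_zero, sub_zero, add_zero]
    at g2 g3 g4 g5 g6 g7 g8
  obtain ⟨-, -, -, -, -, -, -, -, k8⟩ := mu_eq_iff.1 hy
  simp only [← f0, ← f1, ← f2, ← f3, ← f4, ← f5, ← f6, mul_zero, sub_zero, add_zero,
    Pi.zero_apply] at k8
  have hz8 : z8 8 ≠ 0 := by
    intro h
    apply hz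
    ext k
    fin_cases k <;> first | exact h | (symm; assumption)
  rw [← g8] at hz8
  obtain ⟨hx, hz7⟩ := mul_ne_zero_iff.1 hz8
  have hy0 : y 0 = 0 := (mul_eq_zero.1 k8).resolve_right hz7
  refine ⟨hx, hy0, fun hy1 => hz7 ?_⟩
  rw [← f7, ← e6, ← d5, ← c4, ← b3, ← a2, hy0, hy1]
  ring

/-- Relations between the parameters `a` and `b` of two brackets, read off from a sequence of
vectors that is adapted to `μ_b` and satisfies the bracket relations of `μ_a`. The scalar `s` is
the factor by which the parameters of weight zero are multiplied, `α` and `p` are the first two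
coordinates of `x`. -/
theorem relations_of_adapted {a b x y z2 z3 z4 z5 z6 z7 z8 : Fin 9 → K}
    (hx : x 0 ≠ 0) (hy0 : y 0 = 0) (hy1 : y 1 ≠ 0)
    (h2 : mu b x y = z2) (h3 : mu b x z2 = z3) (h4 : mu b x z3 = z4) (h5 : mu b x z4 = z5)
    (h6 : mu b x z5 = z6) (h7 : mu b x z6 = z7) (h8 : mu b x z7 = z8)
    (h16 : mu b y z6 = a 0 • z8) (h25 : mu b z2 z5 = a 1 • z8) (h34 : mu b z3 z4 = a 3 • z8)
    (h15 : mu b y z5 = (a 0 + a 1) • z7 + a 2 • z8)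
    (h24 : mu b z2 z4 = (a 1 + a 3) • z7 + a 4 • z8) :
    ∃ s : K, s ≠ 0 ∧ y 1 = s * x 0 ^ 2 ∧ a 0 = s * b 0 ∧ a 1 = s * b 1 ∧ a 3 = s * b 3 ∧
      x 0 ^ 2 * a 2 = s * (x 0 * b 2
        - x 1 * (2 * b 0 ^ 2 + 6 * b 0 * b 1 + 5 * b 1 * b 3 + 9 * b 1 ^ 2)) ∧
      x 0 ^ 2 * a 4 = s * (x 0 * b 4
        - x 1 * (3 * b 0 * b 1 + 5 * b 0 * b 3 + 10 * b 1 * b 3 + 3 * b 1 ^ 2 + 5 * b 3 ^ 2)) := by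
  obtain ⟨s, hs⟩ : ∃ s, y 1 = s * x 0 ^ 2 := ⟨y 1 / x 0 ^ 2, by field⟩
  have hs0 : s ≠ 0 := by rintro rfl; exact hy1 (by rw [hs, zero_mul])
  obtain ⟨a0, a1, a2, a3, -⟩ := mu_eq_iff.1 h2
  simp only [hy0, hs, mul_zero, sub_zero] at a2 a3
  obtain ⟨b0, b1, b2, b3, b4, -⟩ := mu_eq_iff.1 h3
  simp only [← a0, ← a1, ← a2, ← a3, mul_zero, sub_zero] at b2 b3 b4
  obtain ⟨c0, c1, c2, c3, c4, c5, -⟩ := mu_eq_iff.1 h4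
  simp only [← b0, ← b1, ← b2, ← b3, ← b4, mul_zero, sub_zero, add_zero] at c2 c3 c4 c5
  obtain ⟨d0, d1, d2, d3, d4, d5, d6, -⟩ := mu_eq_iff.1 h5
  simp only [← c0, ← c1, ← c2, ← c3, ← c4, ← c5, mul_zero, sub_zero, add_zero]
    at d2 d3 d4 d5 d6
  obtain ⟨e0, e1, e2, e3, e4, e5, e6, e7, -⟩ := mu_eq_iff.1 h6
  simp only [← d0, ← d1, ← d2, ← d3, ← d4, ← d5, ← d6, mul_zero, sub_zero, add_zero]
    at e2 e3 e4 e5 e6 e7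
  obtain ⟨f0, f1, f2, f3, f4, f5, f6, f7, f8⟩ := mu_eq_iff.1 h7
  simp only [← e0, ← e1, ← e2, ← e3, ← e4, ← e5, ← e6, ← e7, mul_zero, sub_zero, add_zero]
    at f2 f3 f4 f5 f6 f7 f8
  obtain ⟨-, -, -, -, -, -, -, -, g8⟩ := mu_eq_iff.1 h8
  simp only [← f0, ← f1, ← f2, ← f3, ← f4, ← f5, ← f6, ← f7, mul_zero, sub_zero, add_zero]
    at g8
  obtain ⟨-, -, -, -, -, -, -, -, k16⟩ := mu_eq_iff.1 h16
  obtain ⟨-, -, -, -, -, -, -, -, k25⟩ := mu_eq_iff.1 h25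
  obtain ⟨-, -, -, -, -, -, -, -, k34⟩ := mu_eq_iff.1 h34
  obtain ⟨-, -, -, -, -, -, -, -, k15⟩ := mu_eq_iff.1 h15
  obtain ⟨-, -, -, -, -, -, -, -, k24⟩ := mu_eq_iff.1 h24
  simp only [← a0, ← a1, ← a2, ← a3, ← b0, ← b1, ← b2, ← b3, ← b4, ← c0, ← c1, ← c2, ← c3, ← c4,
    ← c5, ← d0, ← d1, ← d2, ← d3, ← d4, ← d5, ← d6, ← e0, ← e1, ← e2, ← e3, ← e4, ← e5, ← e6,
    ← f8, ← g8, hy0, hs, Pi.add_apply, Pi.smul_apply, smul_eq_mul, mul_zero, zero_mul,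
    sub_zero, add_zero, zero_add] at k16 k25 k34 k15 k24
  have hc9 : s * x 0 ^ 9 ≠ 0 := mul_ne_zero hs0 (pow_ne_zero _ hx)
  have hc7 : s * x 0 ^ 7 ≠ 0 := mul_ne_zero hs0 (pow_ne_zero _ hx)
  have ha0 : a 0 = s * b 0 := mul_left_cancel₀ hc9 (by linear_combination -k16)
  have ha1 : a 1 = s * b 1 := mul_left_cancel₀ hc9 (by linear_combination -k25)
  have ha3 : a 3 = s * b 3 := mul_left_cancel₀ hc9 (by linear_combination -k34)
  rw [ha0, ha1] at k15
  rw [ha1, ha3] at k24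
  exact ⟨s, hs0, hs, ha0, ha1, ha3,
    mul_left_cancel₀ hc7 (by linear_combination -k15),
    mul_left_cancel₀ hc7 (by linear_combination -k24)⟩

/-- The relations of weight two, for a unipotent change of basis without component of `x` on
`X_1`. The component of `x` on `X_2` contributes a multiple of the equation of `Fil_9`. -/
theorem relations_of_unipotent {a b x y z2 z3 z4 z5 z6 z7 z8 : Fin 9 → K}
    (hb : b ∈ Fil9 K) (hx0 : x 0 = 1) (hx1 : x 1 = 0) (hy0 : y 0 = 0) (hy1 : y 1 = 1)
    (h0 : a 0 = b 0) (h1 : a 1 = b 1) (h2' : a 2 = b 2) (h3' : a 3 = b 3) (h4' : a 4 = b 4)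
    (h2 : mu b x y = z2) (h3 : mu b x z2 = z3) (h4 : mu b x z3 = z4) (h5 : mu b x z4 = z5)
    (h6 : mu b x z5 = z6) (h7 : mu b x z6 = z7) (h8 : mu b x z7 = z8)
    (h14 : mu b y z4 = (a 0 + 2 * a 1 + a 3) • z6 + (a 2 + a 4) • z7 + a 5 • z8)
    (h23 : mu b z2 z3 = (a 1 + a 3) • z6 + a 4 • z7 + a 6 • z8) :
    ∃ w : K, a 5 = b 5 + w * b 1 ∧ a 6 = b 6 + w * b 3 := by
  have hb' : -3 * (b 1) ^ 2 + 2 * (b 3) ^ 2 + 2 * b 0 * b 3 + b 1 * b 3 = 0 := hb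
  obtain ⟨a0, a1, a2, a3, a4, -⟩ := mu_eq_iff.1 h2
  simp only [hy0, hx0, hx1, hy1, mul_zero, mul_one, one_mul, zero_mul, sub_zero]
    at a2 a3 a4
  obtain ⟨b0, b1, b2, b3, b4, b5, -⟩ := mu_eq_iff.1 h3
  simp only [hx0, hx1, ← a0, ← a1, ← a2, ← a3, ← a4, mul_zero, mul_one, one_mul, zero_mul,
    sub_zero, add_zero] at b2 b3 b4 b5
  obtain ⟨c0, c1, c2, c3, c4, c5, c6, -⟩ := mu_eq_iff.1 h4
  simp only [hx0, hx1, ← b0, ← b1, ← b2, ← b3, ← b4, ← b5, mul_zero, mul_one, one_mul, zero_mul,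
    sub_zero, add_zero] at c2 c3 c4 c5 c6
  obtain ⟨d0, d1, d2, d3, d4, d5, d6, d7, -⟩ := mu_eq_iff.1 h5
  simp only [hx0, hx1, ← c0, ← c1, ← c2, ← c3, ← c4, ← c5, ← c6, mul_zero, mul_one, one_mul,
    zero_mul, sub_zero, add_zero] at d2 d3 d4 d5 d6 d7
  obtain ⟨e0, e1, e2, e3, e4, e5, e6, e7, e8⟩ := mu_eq_iff.1 h6
  simp only [hx0, hx1, ← d0, ← d1, ← d2, ← d3, ← d4, ← d5, ← d6, ← d7, mul_zero, mul_one,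
    one_mul, zero_mul, sub_zero, add_zero] at e2 e3 e4 e5 e6 e7 e8
  obtain ⟨f0, f1, f2, f3, f4, f5, f6, f7, f8⟩ := mu_eq_iff.1 h7
  simp only [hx0, hx1, ← e0, ← e1, ← e2, ← e3, ← e4, ← e5, ← e6, ← e7, mul_zero, mul_one,
    one_mul, sub_zero, add_zero] at f2 f3 f4 f5 f6 f7 f8
  obtain ⟨-, -, -, -, -, -, -, -, g8⟩ := mu_eq_iff.1 h8
  simp only [hx0, hx1, ← f0, ← f1, ← f2, ← f3, ← f4, ← f5, ← f6, ← f7, mul_zero, mul_one,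
    sub_zero, add_zero] at g8
  obtain ⟨-, -, -, -, -, -, -, -, k14⟩ := mu_eq_iff.1 h14
  obtain ⟨-, -, -, -, -, -, -, -, k23⟩ := mu_eq_iff.1 h23
  simp only [← a0, ← a1, ← a2, ← a3, ← a4, ← b0, ← b1, ← b2, ← b3, ← b4, ← b5, ← c0, ← c1, ← c2,
    ← c3, ← c4, ← c5, ← c6, ← e8, ← f8, ← g8, hy0, hy1, h0, h1, h2', h3', h4', Pi.add_apply,
    Pi.smul_apply, smul_eq_mul, mul_zero, zero_mul, mul_one, one_mul, sub_zero, add_zero, zero_add,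
    zero_sub] at k14 k23
  exact ⟨y 2 ^ 2 - 2 * y 3, by linear_combination -k14,
    by linear_combination -k23 + x 2 * hb'⟩

/-- Isomorphic algebras have parameters of weight zero that are proportional, and parameters of
weight one that are related as under the change of basis `X_0 ↦ α X_0 + p X_1`. If the
change of basis is unipotent and `p = 0`, the parameters of weight two are related as well. -/
theorem IsIsomorphic.relations {a b : Fin 9 → K} (h : IsIsomorphic (mu a) (mu b)) :
    ∃ s α p : K, s ≠ 0 ∧ α ≠ 0 ∧ a 0 = s * b 0 ∧ a 1 = s * b 1 ∧ a 3 = s * b 3 ∧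
      α ^ 2 * a 2 = s * (α * b 2
        - p * (2 * b 0 ^ 2 + 6 * b 0 * b 1 + 5 * b 1 * b 3 + 9 * b 1 ^ 2)) ∧
      α ^ 2 * a 4 = s * (α * b 4
        - p * (3 * b 0 * b 1 + 5 * b 0 * b 3 + 10 * b 1 * b 3 + 3 * b 1 ^ 2 + 5 * b 3 ^ 2)) ∧
      (s = 1 → α = 1 → p = 0 → b ∈ Fil9 K →
        ∃ w : K, a 5 = b 5 + w * b 1 ∧ a 6 = b 6 + w * b 3) := by
  obtain ⟨e, he⟩ := h
  have hz : ∀ i j : Fin 9, 1 ≤ i → i < j → mu b (e (X i)) (e (X j)) = e (table a i j) :=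
    fun i j hi hij => by rw [← he, mu_X_of_lt a hi hij]
  have h0 : ∀ j : Fin 9, 1 ≤ j → j ≤ 7 → mu b (e (X 0)) (e (X j)) = e (X (j + 1)) :=
    fun j h1 h7 => by rw [← he, mu_X_zero a h1 h7]
  have h2 := h0 1 (by decide) (by decide)
  have h3 := h0 2 (by decide) (by decide)
  have h4 := h0 3 (by decide) (by decide)
  have h5 := h0 4 (by decide) (by decide)
  have h6 := h0 5 (by decide) (by decide)
  have h7 := h0 6 (by decide) (by decide)
  have h8 := h0 7 (by decide) (by decide)
  have h17 : mu b (e (X 1)) (e (X 7)) = 0 :=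
    (hz 1 7 (by decide) (by decide)).trans (map_zero e)
  have h16 : mu b (e (X 1)) (e (X 6)) = a 0 • e (X 8) :=
    (hz 1 6 (by decide) (by decide)).trans (map_smul e _ _)
  have h25 : mu b (e (X 2)) (e (X 5)) = a 1 • e (X 8) :=
    (hz 2 5 (by decide) (by decide)).trans (map_smul e _ _)
  have h34 : mu b (e (X 3)) (e (X 4)) = a 3 • e (X 8) :=
    (hz 3 4 (by decide) (by decide)).trans (map_smul e _ _)
  have h15 : mu b (e (X 1)) (e (X 5)) = (a 0 + a 1) • e (X 7) + a 2 • e (X 8) :=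
    (hz 1 5 (by decide) (by decide)).trans (by simp only [table, map_add, map_smul])
  have h24 : mu b (e (X 2)) (e (X 4)) = (a 1 + a 3) • e (X 7) + a 4 • e (X 8) :=
    (hz 2 4 (by decide) (by decide)).trans (by simp only [table, map_add, map_smul])
  have h14 : mu b (e (X 1)) (e (X 4)) =
      (a 0 + 2 * a 1 + a 3) • e (X 6) + (a 2 + a 4) • e (X 7) + a 5 • e (X 8) :=
    (hz 1 4 (by decide) (by decide)).trans (by simp only [table, map_add, map_smul])
  have h23 : mu b (e (X 2)) (e (X 3)) = (a 1 + a 3) • e (X 6) + a 4 • e (X 7) + a 6 • e (X 8) :=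
    (hz 2 3 (by decide) (by decide)).trans (by simp only [table, map_add, map_smul])
  have hne : e (X 8) ≠ 0 := by
    rw [e.map_ne_zero_iff]
    exact fun h => one_ne_zero (α := K) (by simpa [X] using congrFun h 8)
  obtain ⟨hx, hy0, hy1⟩ := adapted_leading h2 h3 h4 h5 h6 h7 h8 h17 hne
  obtain ⟨s, hs, hsy, r0, r1, r3, r2, r4⟩ :=
    relations_of_adapted hx hy0 hy1 h2 h3 h4 h5 h6 h7 h8 h16 h25 h34 h15 h24
  refine ⟨s, _, _, hs, hx, r0, r1, r3, r2, r4, fun hs1 hx1 hp hb => ?_⟩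
  rw [hs1, hx1, hp] at r2 r4
  refine relations_of_unipotent hb hx1 hp hy0 (by rw [hsy, hs1, hx1]; ring) (by rw [r0, hs1]; ring)
    (by rw [r1, hs1]; ring) ?_ (by rw [r3, hs1]; ring) ?_ h2 h3 h4 h5 h6 h7 h8 h14 h23
  · linear_combination r2
  · linear_combination r4

section

/-- `genericity` is a relative invariant, like `relInvariant`. -/
theorem IsIsomorphic.genericity_ne_zero {a b : Fin 9 → K} (h : IsIsomorphic (mu a) (mu b))
    (hb : genericity b ≠ 0) : genericity a ≠ 0 := by
  obtain ⟨s, α, p, hs, hα, h0, h1, h3, h2, h4, -⟩ := h.relations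
  have hI : α * relInvariant a = s ^ 3 * relInvariant b := by
    refine mul_left_cancel₀ hα ?_
    simp only [relInvariant, h0, h1, h3]
    linear_combination (3 * s * b 0 * s * b 1 + 5 * s * b 0 * s * b 3 + 10 * s * b 1 * s * b 3
        + 3 * (s * b 1) ^ 2 + 5 * (s * b 3) ^ 2) * h2
      - (2 * (s * b 0) ^ 2 + 6 * s * b 0 * s * b 1 + 5 * s * b 1 * s * b 3 + 9 * (s * b 1) ^ 2) * h4
  have hg : α * genericity a = s ^ 7 * genericity b := by
    simp only [genericity, h1, h3]
    linear_combination (s * b 1 * (s * b 3) * (s * b 1 + s * b 3) * (2 * (s * b 1) + s * b 3)) * hI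
  intro h
  rw [h, mul_zero] at hg
  exact mul_ne_zero (pow_ne_zero 7 hs) hb hg.symm

variable [CharZero K]

omit [CharZero K] in
theorem add_one_ne_zero_of_mem {s : Fin 2 → K} (hs : s ∈ familyDomain K) : s 0 + 1 ≠ 0 :=
  fun h => hs.2.1 (eq_neg_of_add_eq_zero_left h)

theorem two_mul_add_one_ne_zero_of_mem {s : Fin 2 → K} (hs : s ∈ familyDomain K) :
    2 * s 0 + 1 ≠ 0 := by
  intro h
  refine hs.2.2 ?_
  linear_combination h / 2

theorem shear_ne_zero_of_mem {s : Fin 2 → K} (hs : s ∈ familyDomain K) :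
    9 * s 0 * (s 0 + 1) ^ 2 / 2 ≠ 0 :=
  div_ne_zero (mul_ne_zero (mul_ne_zero (by norm_num) hs.1)
    (pow_ne_zero 2 (add_one_ne_zero_of_mem hs))) two_ne_zero

theorem genericity_family_ne_zero {s : Fin 2 → K} (hs : s ∈ familyDomain K) :
    genericity (family s) ≠ 0 := by
  have h : genericity (family s) =
      s 0 * (s 0 + 1) * (2 * s 0 + 1) * (9 * s 0 * (s 0 + 1) ^ 2 / 2) := by
    rw [family_eq_unitPoint, genericity, relInvariant_unitPoint]
    simp only [unitPoint, Matrix.cons_val]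
    ring
  rw [h]
  exact mul_ne_zero (mul_ne_zero (mul_ne_zero hs.1 (add_one_ne_zero_of_mem hs))
    (two_mul_add_one_ne_zero_of_mem hs)) (shear_ne_zero_of_mem hs)

theorem orbit_family :
    orbit (family '' familyDomain K) = {a ∈ Fil9 K | genericity a ≠ 0} := by
  ext a
  constructor
  · rintro ⟨ha, _, ⟨s, hs, rfl⟩, h⟩
    exact ⟨ha, h.genericity_ne_zero (genericity_family_ne_zero hs)⟩
  · rintro ⟨ha, hg⟩
    obtain ⟨s, hs, h⟩ := exists_isIsomorphic_family ha hg
    exact ⟨ha, _, ⟨s, hs, rfl⟩, h⟩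

theorem family_mem_Fil9 (s : Fin 2 → K) : family s ∈ Fil9 K := by
  rw [family_eq_unitPoint]
  exact unitPoint_mem_Fil9 ..

/-- The members of the family are pairwise non-isomorphic. The parameter `a_6 = 1` forces `s = 1`
in the relations between isomorphic algebras, then `a_7 = 0` forces `p = 0`, and `a_5 = 1` forces
`α = 1`; finally `a_9 = 0` shows that the parameter `a_8` is an invariant. -/
theorem eq_of_isIsomorphic_family {s s' : Fin 2 → K} (hs' : s' ∈ familyDomain K)
    (h : IsIsomorphic (mu (family s)) (mu (family s'))) : s = s' := by
  obtain ⟨c, α, p, hc, hα, -, h1, h3, h2, h4, h56⟩ := h.relations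
  simp only [family, Matrix.cons_val, mul_one] at h1 h2 h3 h4 h56
  obtain rfl : c = 1 := h3.symm
  have hp : p * (9 * s' 0 * (s' 0 + 1) ^ 2 / 2) = 0 := by linear_combination h4
  have hp0 : p = 0 := (mul_eq_zero.1 hp).resolve_right (shear_ne_zero_of_mem hs')
  have hα1 : α = 1 := by
    refine mul_left_cancel₀ hα ?_
    rw [hp0] at h2
    linear_combination h2
  obtain ⟨w, h5, h6⟩ := h56 rfl hα1 hp0 (family_mem_Fil9 s')
  have hw : w = 0 := by linear_combination -h6
  ext k
  fin_cases k
  · change s 0 = s' 0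
    linear_combination h1
  · change s 1 = s' 1
    rw [h5, hw]
    ring

/-! ### Zariski topology -/

omit [CharZero K] in
theorem aeval_genericity (a : Fin 9 → K) :
    MvPolynomial.aeval a (genericity (MvPolynomial.X : Fin 9 → MvPolynomial (Fin 9) K)) =
      genericity a := by
  simp [genericity, relInvariant]

omit [CharZero K] in
theorem isZariskiOpenIn_sep {n : ℕ} (V : Set (Fin n → K)) (P : MvPolynomial (Fin n) K) :
    IsZariskiOpenIn {x ∈ V | MvPolynomial.aeval x P ≠ 0} V := by
  refine ⟨Ideal.span {P}, ?_⟩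
  rw [MvPolynomial.zeroLocus_span]
  ext x
  simp

theorem isRigidFamily_family : IsRigidFamily (familyDomain K) family where
  nonempty := ⟨fun _ => 1, one_ne_zero, by norm_num, by norm_num⟩
  isOpen_domain := by
    convert isZariskiOpenIn_sep (Set.univ : Set (Fin 2 → K))
      (MvPolynomial.X 0 * (MvPolynomial.X 0 + 1) * (2 * MvPolynomial.X 0 + 1)) using 1
    ext s
    have h : MvPolynomial.aeval s
        (MvPolynomial.X 0 * (MvPolynomial.X 0 + 1) * (2 * MvPolynomial.X 0 + 1) :
          MvPolynomial (Fin 2) K) = s 0 * (s 0 + 1) * (2 * s 0 + 1) := by simp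
    constructor
    · intro hs
      refine ⟨trivial, ?_⟩
      rw [h]
      exact mul_ne_zero (mul_ne_zero hs.1 (add_one_ne_zero_of_mem hs))
        (two_mul_add_one_ne_zero_of_mem hs)
    · rintro ⟨-, hs⟩
      rw [h] at hs
      refine ⟨fun h0 => hs ?_, fun h0 => hs ?_, fun h0 => hs ?_⟩ <;> rw [h0] <;> ring
  algebraic := by
    refine ⟨![MvPolynomial.C (1 / 2) * (3 * MvPolynomial.X 0 ^ 2 - MvPolynomial.X 0 - 2),
      MvPolynomial.X 0, 1, 1, 0, MvPolynomial.X 1, 0, 0, 0], fun s k => ?_⟩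
    fin_cases k <;> simp [family]
    ring
  mem := fun s _ => family_mem_Fil9 s
  eq_of_isomorphic := fun _ _ _ hs' h => eq_of_isIsomorphic_family hs' h
  isOpen_orbit := by
    rw [orbit_family]
    simpa only [aeval_genericity] using isZariskiOpenIn_sep (Fil9 K) (genericity MvPolynomial.X)

/-- A parametrization of `Fil_9`, given by polynomials: the equation of `Fil_9` defines a cone over
a conic in the space of `(a_2, a_4, a_6)`, and the conic is rational. -/
def conePoint {R : Type*} [CommRing R] (v : Fin 9 → R) : Fin 9 → R :=
  ![v 0 * (3 * v 1 ^ 2 - v 1 * v 2 - 2 * v 2 ^ 2), 2 * v 0 * v 1 * v 2, v 3, 2 * v 0 * v 2 ^ 2,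
    v 4, v 5, v 6, v 7, v 8]

omit [CharZero K] in
theorem conePoint_mem_Fil9 (v : Fin 9 → K) : conePoint v ∈ Fil9 K := by
  simp only [Fil9, conePoint, Set.mem_ofPred_eq, Matrix.cons_val]
  ring

theorem exists_conePoint_eq {a : Fin 9 → K} (ha : a ∈ Fil9 K) : ∃ v, conePoint v = a := by
  have ha' : -3 * (a 1) ^ 2 + 2 * (a 3) ^ 2 + 2 * a 0 * a 3 + a 1 * a 3 = 0 := ha
  by_cases h3 : a 3 = 0
  · have h1 : a 1 = 0 := by
      refine pow_eq_zero_iff two_ne_zero |>.1 ?_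
      rw [h3] at ha'
      linear_combination -ha' / 3
    refine ⟨![a 0 / 3, 1, 0, a 2, a 4, a 5, a 6, a 7, a 8], ?_⟩
    ext k
    fin_cases k <;> simp [conePoint, h1, h3]
  · refine ⟨![a 3 / 2, a 1 / a 3, 1, a 2, a 4, a 5, a 6, a 7, a 8], ?_⟩
    ext k
    fin_cases k <;> simp [conePoint] <;> field_simp
    linear_combination -ha'

/-- The locus of `Fil_9` where `genericity` does not vanish is dense, since `Fil_9` is the image of
an affine space under a polynomial map. -/
theorem Fil9_subset_zariskiClosure :
    Fil9 K ⊆ zariskiClosure {a ∈ Fil9 K | genericity a ≠ 0} := by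
  intro a ha P hP
  obtain ⟨v, rfl⟩ := exists_conePoint_eq ha
  let c : Fin 9 → MvPolynomial (Fin 9) K := conePoint MvPolynomial.X
  have hc : ∀ w : Fin 9 → K, (fun k => MvPolynomial.eval w (c k)) = conePoint w := by
    intro w
    ext k
    fin_cases k <;> simp [c, conePoint]
  have hev : ∀ (Q : MvPolynomial (Fin 9) K) (w : Fin 9 → K),
      MvPolynomial.eval w (MvPolynomial.bind₁ c Q) = MvPolynomial.aeval (conePoint w) Q := by
    intro Q w
    rw [← hc, MvPolynomial.eval, MvPolynomial.eval₂Hom_bind₁]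
    rfl
  have hprod : MvPolynomial.bind₁ c P * MvPolynomial.bind₁ c (genericity MvPolynomial.X) = 0 := by
    refine MvPolynomial.funext fun w => ?_
    rw [map_mul, hev, hev, aeval_genericity, map_zero, mul_eq_zero, or_iff_not_imp_right]
    exact fun h => hP _ ⟨conePoint_mem_Fil9 w, h⟩
  rcases mul_eq_zero.1 hprod with h | h
  · rw [← hev, h, map_zero]
  · have h1 : (fun _ => 1 : Fin 2 → K) ∈ familyDomain K := ⟨one_ne_zero, by norm_num, by norm_num⟩
    obtain ⟨w, hw⟩ := exists_conePoint_eq (family_mem_Fil9 (fun _ => 1 : Fin 2 → K))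
    refine absurd ?_ (genericity_family_ne_zero h1)
    rw [← hw, ← aeval_genericity, ← hev, h, map_zero]

theorem zariskiClosure_orbit_family :
    Fil9 K = zariskiClosure (orbit (family '' familyDomain K)) := by
  rw [orbit_family]
  refine subset_antisymm Fil9_subset_zariskiClosure fun a ha => ?_
  have h := ha (-3 * MvPolynomial.X 1 ^ 2 + 2 * MvPolynomial.X 3 ^ 2
    + 2 * MvPolynomial.X 0 * MvPolynomial.X 3 + MvPolynomial.X 1 * MvPolynomial.X 3) (by
      rintro x ⟨hx, -⟩
      simpa [Fil9] using hx)
  simpa [Fil9] using h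

end

/-! ### Coboundaries -/

theorem mu_X_zero_apply (a y : Fin 9 → K) :
    mu a (X 0) y = ![0, 0, y 1, y 2, y 3, y 4, y 5, y 6, y 7] := by
  rw [mu_eq_iff]
  simp [X]

theorem cochain_X_zero (u : Fin 9 → K) (j : Fin 9) : cochain u (X 0) (X j) = 0 := by
  change altBilin _ _ _ = 0
  rcases eq_or_ne j 0 with rfl | h
  · exact altBilin_self _ _
  · rw [altBilin_X _ (Fin.pos_iff_ne_zero.2 h)]
    rfl

theorem cochain_X_of_lt (u : Fin 9 → K) {i j : Fin 9} (h : i < j) :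
    cochain u (X i) (X j) = table u i j :=
  altBilin_X _ h

theorem coboundary_apply (μ : Bilin K) (f : Module.End K (Fin 9 → K)) (x y : Fin 9 → K) :
    coboundary μ f x y = μ (f x) y + μ x (f y) - f (μ x y) := rfl

theorem cochain_injective : Function.Injective (cochain (K := K)) := by
  rw [injective_iff_map_eq_zero]
  intro u hu
  have h : ∀ i j : Fin 9, i < j → table u i j 8 = 0 := fun i j hij => by
    rw [← cochain_X_of_lt u hij, hu]; rfl
  have h16 := h 1 6 (by decide)
  have h25 := h 2 5 (by decide)
  have h15 := h 1 5 (by decide)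
  have h34 := h 3 4 (by decide)
  have h24 := h 2 4 (by decide)
  have h14 := h 1 4 (by decide)
  have h23 := h 2 3 (by decide)
  have h13 := h 1 3 (by decide)
  have h12 := h 1 2 (by decide)
  simp [table, X] at h16 h25 h15 h34 h24 h14 h23 h13 h12
  ext k
  fin_cases k <;> assumption

/-- Six vectors of parameters, whose span contains the parameters of the coboundaries of the form
`φ_u`. On `Fil_9` they are the derivatives of the action on the parameters of the scalings of `X_0`
and of `X_1`, of `X_0 ↦ X_0 + b X_1`, and of `X_1 ↦ X_1 + c X_k` for `k = 3, 4, 5`. -/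
def tangentVectors (a : Fin 9 → K) : Fin 6 → Fin 9 → K :=
  ![![-2 * a 0, -2 * a 1, -3 * a 2, -2 * a 3, -3 * a 4, -4 * a 5, -4 * a 6, -5 * a 7, -6 * a 8],
    a,
    ![0, 0,
      -(2 * a 0 ^ 2 + 6 * a 0 * a 1 + 5 * a 1 * a 3 + 9 * a 1 ^ 2),
      0,
      -(3 * a 0 * a 1 + 5 * a 0 * a 3 + 10 * a 1 * a 3 + 3 * a 1 ^ 2 + 5 * a 3 ^ 2),
      -(5 * a 0 * a 2 + 6 * a 0 * a 4 + 11 * a 1 * a 2 + 19 * a 1 * a 4 + 5 * a 2 * a 3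
        + 10 * a 3 * a 4),
      -(4 * a 0 * a 4 + 3 * a 1 * a 2 + 9 * a 1 * a 4 + 4 * a 2 * a 3 + 8 * a 3 * a 4),
      -((6 * a 0 + 15 * a 1 + 9 * a 3) * (a 5 + a 6) + 11 * a 2 * a 4 + 3 * a 2 ^ 2
        + 10 * a 4 ^ 2),
      -((7 * a 0 + 15 * a 1 + 9 * a 3) * a 7 + 7 * a 2 * a 5 + 6 * a 2 * a 6 + 11 * a 4 * a 5
        + 9 * a 4 * a 6)],
    ![0, 0, 0, 0, 0, -2 * a 1, -2 * a 3, -2 * a 4, -2 * a 6],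
    ![0, 0, 0, 0, 0, 0, 0, -3 * (a 1 + a 3), -3 * a 4],
    ![0, 0, 0, 0, 0, 0, 0, 0, -(4 * a 1 + 2 * a 3)]]

/-- The parameters of a coboundary `δ f` of the form `φ_u` are a combination of the tangent vectors.
As `δ f` vanishes on the pairs `(X_0, X_i)` with `i ≤ 7`, the images `f X_0` and `f X_1` determine
`f`, and `u` is read off from the components on `X_8`. -/
theorem exists_eq_sum_of_cochain_eq_coboundary {a u : Fin 9 → K} (ha : a ∈ Fil9 K)
    {f : Module.End K (Fin 9 → K)} (h : coboundary (mu a) f = cochain u) :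
    ∃ c : Fin 6 → K, ∑ i, c i • tangentVectors a i = u := by
  have ha' : -3 * (a 1) ^ 2 + 2 * (a 3) ^ 2 + 2 * a 0 * a 3 + a 1 * a 3 = 0 := ha
  have hF : ∀ j : Fin 9, 1 ≤ j → j ≤ 7 →
      f (X (j + 1)) = mu a (f (X 0)) (X j) + mu a (X 0) (f (X j)) := fun j h1 h7 => by
    have := LinearMap.congr_fun₂ h (X 0) (X j)
    rw [cochain_X_zero, coboundary_apply, mu_X_zero a h1 h7, sub_eq_zero] at this
    exact this.symm
  have hu : ∀ i j : Fin 9, 1 ≤ i → i < j →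
      mu a (f (X i)) (X j) + mu a (X i) (f (X j)) = f (table a i j) + table u i j :=
    fun i j hi hij => by
      have := LinearMap.congr_fun₂ h (X i) (X j)
      rw [cochain_X_of_lt u hij, coboundary_apply, mu_X_of_lt a hi hij, sub_eq_iff_eq_add'] at this
      exact this
  generalize hp : f (X 0) = p at hF
  generalize hq : f (X 1) = q at hF
  have h2 : f (X 2) = _ := hF 1 (by decide) (by decide)
  rw [hq] at h2
  have h3 : f (X 3) = _ := hF 2 (by decide) (by decide)
  have h4 : f (X 4) = _ := hF 3 (by decide) (by decide)
  have h5 : f (X 5) = _ := hF 4 (by decide) (by decide)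
  have h6 : f (X 6) = _ := hF 5 (by decide) (by decide)
  have h7 : f (X 7) = _ := hF 6 (by decide) (by decide)
  have h8 : f (X 8) = _ := hF 7 (by decide) (by decide)
  have h16 := congrFun (hu 1 6 (by decide) (by decide)) 8
  have h25 := congrFun (hu 2 5 (by decide) (by decide)) 8
  have h15 := congrFun (hu 1 5 (by decide) (by decide)) 8
  have h34 := congrFun (hu 3 4 (by decide) (by decide)) 8
  have h24 := congrFun (hu 2 4 (by decide) (by decide)) 8
  have h14 := congrFun (hu 1 4 (by decide) (by decide)) 8
  have h23 := congrFun (hu 2 3 (by decide) (by decide)) 8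
  have h13 := congrFun (hu 1 3 (by decide) (by decide)) 8
  have h12 := congrFun (hu 1 2 (by decide) (by decide)) 8
  simp only [table, map_add, map_smul, hq] at h16 h25 h15 h34 h24 h14 h23 h13 h12
  clear h hF hu
  generalize f (X 2) = z2 at *
  generalize f (X 3) = z3 at *
  generalize f (X 4) = z4 at *
  generalize f (X 5) = z5 at *
  generalize f (X 6) = z6 at *
  generalize f (X 7) = z7 at *
  generalize f (X 8) = z8 at *
  rw [mu_X_zero_apply, mu_apply] at h2 h3 h4 h5 h6 h7 h8
  simp [X] at h2 h3 h4 h5 h6 h7 h8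
  simp [mu_apply, X] at h16 h25 h15 h34 h24 h14 h23 h13 h12
  simp [h2, h3, h4, h5, h6, h7, h8] at h16 h25 h15 h34 h24 h14 h23 h13 h12
  -- Modulo the inner derivations by `X_2` and `X_3`, the components of `f X_0` on `X_3` and `X_4`
  -- are traded for components of `f X_1` on `X_4` and `X_5`.
  refine ⟨![p 0, q 1, p 1, q 3, q 4 - (a 0 + 3 * a 1 + 2 * a 3) * p 3,
    q 5 - (a 2 + 2 * a 4) * p 3 - (a 0 + 3 * a 1 + 2 * a 3) * p 4], ?_⟩
  ext k
  fin_cases k <;> simp [Fin.sum_univ_succ, tangentVectors]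
  · linear_combination h16
  · linear_combination h25
  · linear_combination h15
  · linear_combination h34
  · linear_combination h24
  · linear_combination h14
  · linear_combination h23 - p 2 * ha'
  · linear_combination h13 + p 3 * ha'
  · linear_combination h12 - p 4 * ha'

/-- A criterion for the equation `δ f = φ_u`, where `f X_i` is the `i`-th row of a triangular
matrix `Y`. -/
theorem coboundary_vecMulLinear_eq_cochain {a u : Fin 9 → K} (Y : Matrix (Fin 9) (Fin 9) K)
    (hY : ∀ i k, k < i → Y i k = 0)
    (h0 : ∀ i, 1 ≤ i → i ≤ 7 → mu a (Y 0) (X i) + mu a (X 0) (Y i) = Y (i + 1))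
    (h : ∀ i j, 1 ≤ i → i < j → i.val + j.val ≤ 7 →
      mu a (Y i) (X j) + mu a (X i) (Y j) = Matrix.vecMul (table a i j) Y + table u i j) :
    coboundary (mu a) Y.vecMulLinear = cochain u := by
  have hX : ∀ i, Y.vecMulLinear (X i) = Y i := fun i => Matrix.single_one_vecMul i Y
  have hsupp : ∀ i k : Fin 9, k < i → (X i : Fin 9 → K) k = 0 := fun i k hk =>
    Pi.single_eq_of_ne hk.ne _
  refine bilin_ext_of_lt ?_ ?_ (fun x y => altBilin_swap _ x y) (fun x => altBilin_self _ x) ?_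
  · intro x y
    rw [coboundary_apply, coboundary_apply, mu_swap a _ y, mu_swap a x, mu_swap a x, map_neg]
    abel
  · intro x
    rw [coboundary_apply, mu_self, map_zero, mu_swap, neg_add_cancel, sub_zero]
  · intro i j hij
    rw [coboundary_apply, hX, hX]
    rcases eq_or_ne i 0 with rfl | hi
    · have hj : 1 ≤ j := by rw [Fin.lt_def] at hij; rw [Fin.le_def]; exact hij
      rw [cochain_X_zero]
      rcases le_or_gt j 7 with hj7 | hj7
      · rw [mu_X_zero _ hj hj7, hX, h0 j hj hj7, sub_self]
      · obtain rfl : j = 8 := by rw [Fin.lt_def] at hj7; ext; omega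
        have h8 : ∀ k < 8, Y 8 k = 0 := hY 8
        rw [mu_X_zero_X_eight, map_zero, sub_zero, mu_X_zero_apply, mu_apply]
        ext k
        fin_cases k <;> simp (discharger := decide) [h8, X]
    · have hi : 1 ≤ i := by
        rw [Fin.le_def]; exact Nat.one_le_iff_ne_zero.2 fun h' => hi (Fin.ext h')
      rw [mu_X_of_lt _ hi hij, cochain_X_of_lt _ hij, sub_eq_iff_eq_add']
      by_cases hs : i.val + j.val ≤ 7
      · exact h i j hi hij hs
      · rw [mu_eq_zero_of_supported hi (by omega) hij (hY i) (hsupp j),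
          mu_eq_zero_of_supported hi (by omega) hij (hsupp i) (hY j),
          table_eq_zero _ (by omega), table_eq_zero _ (by omega), map_zero]

section

theorem ext_nine {R : Type*} {v w : Fin 9 → R}
    (h : v 0 = w 0 ∧ v 1 = w 1 ∧ v 2 = w 2 ∧ v 3 = w 3 ∧ v 4 = w 4 ∧ v 5 = w 5 ∧ v 6 = w 6 ∧
      v 7 = w 7 ∧ v 8 = w 8) : v = w := by
  obtain ⟨h0, h1, h2, h3, h4, h5, h6, h7, h8⟩ := h
  ext k
  fin_cases k <;> assumption

variable [CharZero K]

set_option maxHeartbeats 400000 in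
/-- Every combination of the tangent vectors at a member of the family is the parameter of the
coboundary of the endomorphism with `X_0 ↦ c_0 X_0 + c_2 X_1` and
`X_1 ↦ c_1 X_1 + c_3 X_3 + c_4 X_4 + c_5 X_5`. -/
theorem cochain_tangentVectors_mem_range (t v : K) (c : Fin 6 → K) :
    cochain (∑ i, c i • tangentVectors (unitPoint t 1 0 v 0 0 0) i) ∈
      LinearMap.range (coboundary (mu (unitPoint t 1 0 v 0 0 0))) := by
  refine ⟨_, coboundary_vecMulLinear_eq_cochain (Matrix.of
    ![![c 0, c 2, 0, 0, 0, 0, 0, 0, 0],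
      ![0, c 1, 0, c 3, c 4, c 5, 0, 0, 0],
      ![0, 0, c 0 + c 1, 0, c 3, c 4, c 5, 0, 0],
      ![0, 0, 0, 2 * c 0 + c 1, (3 * t ^ 2 + 5 * t + 2) / 2 * c 2, c 2 + c 3, v * c 2 + c 4, c 5,
        0],
      ![0, 0, 0, 0, 3 * c 0 + c 1, (3 * t ^ 2 + 5 * t + 2) * c 2, 2 * c 2 + c 3,
        2 * v * c 2 + c 4, c 5],
      ![0, 0, 0, 0, 0, 4 * c 0 + c 1, (9 * t ^ 2 + 13 * t + 4) / 2 * c 2, 3 * c 2 + c 3,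
        3 * v * c 2 + c 4],
      ![0, 0, 0, 0, 0, 0, 5 * c 0 + c 1, (6 * t ^ 2 + 7 * t + 1) * c 2, 4 * c 2 + c 3],
      ![0, 0, 0, 0, 0, 0, 0, 6 * c 0 + c 1, (15 * t ^ 2 + 13 * t) / 2 * c 2],
      ![0, 0, 0, 0, 0, 0, 0, 0, 7 * c 0 + c 1]]) ?_ ?_ ?_⟩
  · intro i k hk
    fin_cases i <;> fin_cases k <;> first | rfl | exact absurd hk (by decide)
  · intro i h1 h7
    rw [mu_X_zero_apply, mu_apply]
    fin_cases i <;> first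
      | exact absurd h1 (by decide)
      | exact absurd h7 (by decide)
      | skip
    all_goals
      refine ext_nine ?_
      simp only [unitPoint, X, Matrix.of_apply, Matrix.cons_val, Pi.add_apply, Pi.single_apply,
        Fin.reduceEq, if_true, if_false, Fin.reduceFinMk, Fin.isValue, Fin.reduceAdd]
      refine ⟨?_, ?_, ?_, ?_, ?_, ?_, ?_, ?_, ?_⟩ <;> first | trivial | ring1
  · intro i j hi hij hs
    rw [vecMul_table, mu_apply, mu_apply]
    fin_cases i <;> fin_cases j <;> first
      | exact absurd hi (by decide)
      | exact absurd hij (by decide)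
      | exact absurd hs (by decide)
      | skip
    all_goals
      refine ext_nine ?_
      simp only [unitPoint, X, table, tangentVectors, Matrix.of_apply, Matrix.cons_val,
        Pi.add_apply, Pi.smul_apply, smul_eq_mul, Pi.single_apply, Fin.reduceEq, if_true, if_false,
        Fin.reduceFinMk, Fin.isValue, Fin.sum_univ_six]
      refine ⟨?_, ?_, ?_, ?_, ?_, ?_, ?_, ?_, ?_⟩ <;> first | trivial | ring1

end

/-! ### Dimensions of the cohomology spaces -/

section

theorem finrank_H2CR_add (a : Fin 9 → K) :
    Module.finrank K (H2CR a) + Module.finrank K (B2CR a) = Module.finrank K (Z2CR a) := by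
  have h : Module.finrank K ((B2CR a).submoduleOf (Z2CR a)) = Module.finrank K (B2CR a) :=
    (Submodule.submoduleOfEquivOfLe inf_le_left).finrank_eq
  rw [← h]
  exact Submodule.finrank_quotient_add_finrank _

theorem finrank_map_cochain (S : Submodule K (Fin 9 → K)) :
    Module.finrank K (S.map cochain) = Module.finrank K S :=
  (Submodule.equivMapOfInjective cochain cochain_injective S).finrank_eq.symm

theorem finrank_Z2CR_add (a : Fin 9 → K) :
    Module.finrank K (Z2CR a) + Module.finrank K (LinearMap.range (tangentForm a)) = 9 := by
  rw [Z2CR, finrank_map_cochain, add_comm, LinearMap.finrank_range_add_finrank_ker,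
    Module.finrank_fin_fun]

theorem finrank_range_tangentForm_le (a : Fin 9 → K) :
    Module.finrank K (LinearMap.range (tangentForm a)) ≤ 1 :=
  (Submodule.finrank_le _).trans_eq (Module.finrank_self K)

theorem B2CR_le {a : Fin 9 → K} (ha : a ∈ Fil9 K) :
    B2CR a ≤ (Submodule.span K (Set.range (tangentVectors a))).map cochain := by
  rintro _ ⟨⟨u, -, rfl⟩, f, hf⟩
  obtain ⟨c, rfl⟩ := exists_eq_sum_of_cochain_eq_coboundary ha hf
  exact ⟨_, Submodule.sum_mem _ fun i _ => Submodule.smul_mem _ _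
    (Submodule.subset_span ⟨i, rfl⟩), rfl⟩

theorem finrank_B2CR_le {a : Fin 9 → K} (ha : a ∈ Fil9 K) : Module.finrank K (B2CR a) ≤ 6 :=
  calc Module.finrank K (B2CR a)
      ≤ Module.finrank K ((Submodule.span K (Set.range (tangentVectors a))).map cochain) :=
        Submodule.finrank_mono (B2CR_le ha)
    _ = Module.finrank K (Submodule.span K (Set.range (tangentVectors a))) :=
        finrank_map_cochain _
    _ ≤ 6 := (finrank_range_le_card (R := K) (tangentVectors a)).trans_eq (Fintype.card_fin 6)

theorem two_le_finrank_H2CR {a : Fin 9 → K} (ha : a ∈ Fil9 K) :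
    2 ≤ Module.finrank K (H2CR a) := by
  have h1 := finrank_H2CR_add a
  have h2 := finrank_Z2CR_add a
  have h3 := finrank_range_tangentForm_le a
  have h4 := finrank_B2CR_le ha
  omega

variable [CharZero K]

theorem finrank_Z2CR_family (s : Fin 2 → K) : Module.finrank K (Z2CR (family s)) = 8 := by
  have h : LinearMap.range (tangentForm (family s)) = ⊤ := by
    refine LinearMap.range_eq_top.2 (LinearMap.surjective fun h => ?_)
    have := LinearMap.congr_fun h (X 0)
    simp [tangentForm, family, X] at this
  have h2 := finrank_Z2CR_add (family s)
  rw [h, finrank_top, Module.finrank_self] at h2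
  omega

theorem tangentForm_tangentVectors {a : Fin 9 → K} (ha : a ∈ Fil9 K) (i : Fin 6) :
    tangentForm a (tangentVectors a i) = 0 := by
  have ha' : -3 * (a 1) ^ 2 + 2 * (a 3) ^ 2 + 2 * a 0 * a 3 + a 1 * a 3 = 0 := ha
  fin_cases i <;> simp [tangentForm, tangentVectors]
  · linear_combination -2 * ha'
  · linear_combination ha'

theorem linearIndependent_tangentVectors {s : Fin 2 → K} (hs : s ∈ familyDomain K) :
    LinearIndependent K (tangentVectors (family s)) := by
  rw [Fintype.linearIndependent_iff]
  intro c hc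
  have h1 := add_one_ne_zero_of_mem hs
  have h2 := two_mul_add_one_ne_zero_of_mem hs
  have hv : ∀ k, (∑ i, c i • tangentVectors (family s) i) k = 0 := fun k => by rw [hc]; rfl
  simp only [Fin.sum_univ_six, Pi.add_apply, Pi.smul_apply, smul_eq_mul] at hv
  have e2 := hv 2
  have e3 := hv 3
  have e4 := hv 4
  have e6 := hv 6
  have e7 := hv 7
  have e8 := hv 8
  simp only [tangentVectors, family, Matrix.cons_val] at e2 e3 e4 e6 e7 e8
  have c2 : c 2 = 0 := by
    refine (mul_eq_zero.1 ?_).resolve_right (shear_ne_zero_of_mem hs)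
    linear_combination -e4
  rw [c2] at e2 e6 e7 e8
  have c0 : c 0 = 0 := by linear_combination e3 - e2
  have c1 : c 1 = 0 := by linear_combination e3 + 2 * c0
  have c3 : c 3 = 0 := by linear_combination -e6 / 2
  have c4 : c 4 = 0 := by
    refine (mul_eq_zero.1 ?_).resolve_right h1
    linear_combination -e7 / 3
  have c5 : c 5 = 0 := by
    refine (mul_eq_zero.1 ?_).resolve_right h2
    linear_combination -e8 / 2
  intro i
  fin_cases i <;> assumption

theorem finrank_B2CR_family {s : Fin 2 → K} (hs : s ∈ familyDomain K) :
    Module.finrank K (B2CR (family s)) = 6 := by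
  have hF := family_mem_Fil9 s
  have h : B2CR (family s) =
      (Submodule.span K (Set.range (tangentVectors (family s)))).map cochain := by
    refine le_antisymm (B2CR_le hF) (Submodule.map_le_iff_le_comap.2 ?_)
    intro w hw
    refine ⟨Submodule.mem_map_of_mem ?_, ?_⟩
    · refine Submodule.span_le.2 ?_ hw
      rintro _ ⟨i, rfl⟩
      exact tangentForm_tangentVectors hF i
    · obtain ⟨c, rfl⟩ := (Submodule.mem_span_range_iff_exists_fun K).1 hw
      exact cochain_tangentVectors_mem_range (s 0) (s 1) c
  rw [h, finrank_map_cochain, finrank_span_eq_card (linearIndependent_tangentVectors hs),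
    Fintype.card_fin]

theorem finrank_H2CR_family {s : Fin 2 → K} (hs : s ∈ familyDomain K) :
    Module.finrank K (H2CR (family s)) = 2 := by
  have h1 := finrank_H2CR_add (family s)
  rw [finrank_B2CR_family hs, finrank_Z2CR_family] at h1
  omega

end

end Filiform9

theorem theorem24 (K : Type*) [Field K] [IsAlgClosed K] [CharZero K] :
    Filiform9.IsRigidFamily (Filiform9.familyDomain K) Filiform9.family ∧
    Filiform9.Fil9 K =
      Filiform9.zariskiClosure
        (Filiform9.orbit (Filiform9.family '' Filiform9.familyDomain K)) ∧
    (∀ s ∈ Filiform9.familyDomain K,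
      Module.finrank K (Filiform9.H2CR (Filiform9.family s)) = 2) ∧
    IsLeast {d : ℕ | ∃ a ∈ Filiform9.Fil9 K, Module.finrank K (Filiform9.H2CR a) = d} 2 := by
  refine ⟨Filiform9.isRigidFamily_family, Filiform9.zariskiClosure_orbit_family,
    fun s hs => Filiform9.finrank_H2CR_family hs, ?_, ?_⟩
  · obtain ⟨s, hs⟩ := (Filiform9.isRigidFamily_family (K := K)).nonempty
    exact ⟨_, Filiform9.family_mem_Fil9 s, Filiform9.finrank_H2CR_family hs⟩
  · rintro d ⟨a, ha, rfl⟩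
    exact Filiform9.two_le_finrank_H2CR ha
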